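/- **Proposition (exponential law).** Let $\mathcal X$ be a finite set with a symmetric relation $\sim$ that makes it a connected graph, and let $H:\mathcal X\to\mathbb R$. For $\beta>0$ let $X=X^{(\beta)}$ be the continuous-time Metropolis chain on $\mathcal X$ at inverse temperature $\beta$, i.e. the right-continuous Markov process with generator $$L_xf=\sum_{y\sim x}e^{-\beta[H(y)-H(x)]_+}\,\bigl(f(y)-f(x)\bigr).$$ Write $P_x$, $E_x$ for its law and expectation when $X(0)=x$, and $\tau_D=\inf\{t\ge 0: X(t)\in D\}$ for $D\subset\mathcal X$, with $\tau_b=\tau_{\{b\}}$. For $x,y\in\mathcal X$ let $\Phi(x,y)$ be the minimum over all paths from $x$ to $y$ (the trivial path is allowed if $x=y$) of the maximum of $H$ along the path. Let $a,b\in\mathcal X$ and $\mathcal G\subset\mathcal X$ be such that, with $\Gamma=\Phi(a,b)-H(a)$: * **(P1)** $b$ is the only global minimum of $H$; * **(P2)** $\Phi(x,b)-H(x)<\Gamma$ for all $x\in\mathcal X\setminus\{a\}$; * **(P3)** all elements of $\mathcal G$ have the same energy, denoted by $H(\mathcal G)$, and every path from $a$ to $b$ along which the maximum of $H$ equals $\Phi(a,b)$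 crosses $\mathcal G$ and reaches its maximum in $\mathcal G$ (so that $\Gamma=H(\mathcal G)-H(a)$); * **(P4)** if $A$ and $B$ are the connected components of $a$ and $b$ in $\{x: H(x)<H(\mathcal G)\}$, then each element of $\mathcal G$ lies outside $A$ and is a neighbour of some element of $A$. Then, for every $\beta>0$, $E_a[\tau_b]$ and $E_a[\tau_B]$ are positive and finite, and, as $\beta\to+\infty$, the random variables $$\theta_b=\frac{\tau_b}{E_a[\tau_b]}\qquad\text{and}\qquad\theta_B=\frac{\tau_B}{E_a[\tau_B]}$$ converge in law under $P_a$ to an exponential random variable of mean $1$. -/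

import Mathlib

open Filter Topology MeasureTheory ProbabilityTheory
open scoped NNReal ENNReal

noncomputable section

namespace Metropolis

/-! ### The Metropolis dynamics -/

section Dynamics

variable {V : Type*} [Fintype V] [DecidableEq V] (G : SimpleGraph V) [DecidableRel G.Adj]
  (H : V → ℝ) (β : ℝ)

/-- The Metropolis jump rate `exp (-β [H y - H x]₊)` from `x` to `y` if `x ∼ y`, and `0`
otherwise. -/
def rate (x y : V) : ℝ :=
  if G.Adj x y then Real.exp (-β * max (H y - H x) 0) else 0

/-- The generator of the Metropolis dynamics, as a matrix: the jump rates off the diagonal,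
minus the total jump rate on the diagonal. -/
def generator : Matrix V V ℝ :=
  Matrix.of (rate G H β) - Matrix.diagonal (fun x => ∑ y, rate G H β x y)

/-- The generator acts on functions by
`(L f) x = ∑_{y ∼ x} exp (-β [H y - H x]₊) (f y - f x)`. -/
theorem generator_mulVec (f : V → ℝ) (x : V) :
    (generator G H β).mulVec f x =
      ∑ y ∈ G.neighborFinset x, Real.exp (-β * max (H y - H x) 0) * (f y - f x) := by
  have h : (generator G H β).mulVec f x = ∑ y, rate G H β x y * (f y - f x) := by
    rw [generator, Matrix.sub_mulVec, Pi.sub_apply, Matrix.mulVec_diagonal, Finset.sum_mul,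
      Matrix.mulVec, dotProduct, ← Finset.sum_sub_distrib]
    exact Finset.sum_congr rfl fun y _ => by rw [Matrix.of_apply]; ring
  rw [h, SimpleGraph.neighborFinset_eq_filter, Finset.sum_filter]
  exact Finset.sum_congr rfl fun y _ => by rw [rate]; split_ifs <;> simp

/-- The transition semigroup `exp (t L)` of the Metropolis dynamics. -/
def semigroup (t : ℝ) : Matrix V V ℝ :=
  NormedSpace.exp (t • generator G H β)

/-- `X` is, under the probability `P`, a continuous time Markov chain started from `a` whose
generator is the Metropolis generator at inverse temperature `β`: its paths are right-continuous
(for the discrete topology of the state space) and its finite dimensional distributions are those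
of the Markov process with initial state `a` and transition semigroup `exp (t L)`. -/
structure IsMetropolisChain (a : V) {Ω : Type*} [MeasurableSpace Ω] (P : Measure Ω)
    (X : ℝ≥0 → Ω → V) : Prop where
  measurableSet_eq : ∀ t x, MeasurableSet {ω | X t ω = x}
  rightContinuous : ∀ ω t, ∀ᶠ s in 𝓝[≥] t, X s ω = X t ω
  finDimDistr : ∀ (n : ℕ) (t : ℕ → ℝ≥0) (x : ℕ → V), t 0 = 0 → Monotone t →
    P.real {ω | ∀ k ≤ n, X (t k) ω = x k} =
      (if x 0 = a then 1 else 0) *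
        ∏ k ∈ Finset.range n, semigroup G H β ((t (k + 1) : ℝ) - t k) (x k) (x (k + 1))

end Dynamics

/-- The hitting time `inf {t ≥ 0 | X t ∈ D}`, equal to `∞` if `X` never visits `D`. -/
def hittingTime {V Ω : Type*} (X : ℝ≥0 → Ω → V) (D : Set V) (ω : Ω) : ℝ≥0∞ :=
  hittingAfter X D 0 ω

/-- The exponential law of mean `1` is a probability measure. -/
instance : IsProbabilityMeasure (expMeasure 1) :=
  isProbabilityMeasure_expMeasure one_pos

/-! ### The energy landscape -/

section Landscape

variable {V : Type*} {G : SimpleGraph V} (H : V → ℝ)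

/-- The height `H(x) ∨ max_{e ∈ γ} H(e₊)` of a path `γ` starting from `x`. -/
def height : {x y : V} → G.Walk x y → ℝ
  | x, _, .nil => H x
  | x, _, .cons _ p => max (H x) (height p)

variable (G)

/-- The communication height between `x` and `y`: the minimal height of a path from `x` to `y`.
On a finite connected graph the heights form a nonempty finite set of reals, so that the infimum
is a minimum. -/
def commHeight (x y : V) : ℝ :=
  ⨅ p : G.Walk x y, height H p

/-- The energy barrier `Γ` between `a` and `b`. -/
def barrier (a b : V) : ℝ :=
  commHeight G H a b - H a

/-- The set of configurations of energy smaller than the energy of the gate (all elements of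
which have the same energy in the situation below). -/
def belowGate (gate : Set V) : Set V :=
  {x | ∀ g ∈ gate, H x < H g}

/-- The connected component of `x` in the set `S` (the states that can be reached from `x` by a
path that stays in `S`). -/
def component (S : Set V) (x : V) : Set V :=
  {y | ∃ p : G.Walk x y, ∀ z ∈ p.support, z ∈ S}

/-- The cycle of `x`: its connected component in the set of configurations of energy smaller than
the energy of the gate. -/
def cycleOf (gate : Set V) (x : V) : Set V :=
  component G (belowGate H gate) x

/-- The external border of a set of states. -/
def externalBorder (S : Set V) : Set V :=
  {y | y ∉ S ∧ ∃ x ∈ S, G.Adj x y}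

/-- The metastable situation: properties (P1)-(P4) of the states `a` and `b` and of the set
`gate`. -/
structure IsMetastable (a b : V) (gate : Set V) : Prop where
  /-- (P1): `b` is the only fundamental state. -/
  fundamental : ∀ x, x ≠ b → H b < H x
  /-- (P2): `a` is the only metastable state. -/
  metastable : ∀ x, x ≠ a → barrier G H x b < barrier G H a b
  /-- (P3): the gate consists of configurations at a same energy. -/
  gate_energy : ∀ g ∈ gate, ∀ g' ∈ gate, H g = H g'
  /-- (P3): any path that realizes the min-max between `a` and `b` crosses the gate and reaches
  its maximum in it. -/
  gate_property : ∀ p : G.Walk a b, height H p = commHeight G H a b →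
    ∃ g ∈ p.support, g ∈ gate ∧ H g = height H p
  /-- (P4): the gate is contained in the external border of the cycle of `a`. -/
  gate_subset : gate ⊆ externalBorder G (cycleOf G H gate a)

end Landscape

end Metropolis

end

/-! The law of the hitting time `τ` of `D` enters only through two Dirichlet problems vanishing on
`D`. One is `L T = -1`, with `T a` the mean of `τ`. The other is `L ψ + i l ψ = -i l`, with `1 + ψ
a` the characteristic function of `τ` at `l` (`lintegral_hittingTime`, `integral_exp_hittingTime`).

Let `g` be the Green function with pole `a` and `m = exp (-β H)` the reversible measure. By
reversibility `m x * g x / m a` is the mean time spent at `x` before `D` by the chain started from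
`a`. Hence `m a * T a = ∑ m g` and `m a * ψ a = i l ∑ m g (1 + ψ)`. If `m g` concentrates at `a`,
the choice `l = u / T a` turns the second identity into `ψ a ≈ i u (1 + ψ a)`. Then `1 + ψ a ≈ 1 /
(1 - i u)`, the exponential characteristic function (`exists_charFun_bound`).

Concentration is `exists_green_decay`. The flow of `g` through any edge is at most the total flow `m
a`, so summing along an optimal path bounds `g x` by a constant times `exp (β (Φ(x,b) - H a))`.
Conversely, all the flow crosses the border of the cycle of `a`, where conductances are at most `exp
(-β Φ(a,b))`, so `g a` is at least a constant times `exp (β Γ)`. The resulting ratio decays like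
`exp (-β (Γ - (Φ(x,b) - H x)))`, and the exponent is strictly negative by (P2).

The link with the process is that its transition function killed on `D` is the exponential of the
killed generator. It is obtained by observing right-continuous paths at dyadic times and applying
Chernoff's product formula. -/

noncomputable section

namespace Metropolis

/-! ### Dirichlet problems for irreducible rates. -/

section Dirichlet

variable {V : Type*} [Fintype V]

/-- The rates `q` are irreducible: no proper nonempty set of states is closed. -/
def IsIrreducible (q : V → V → ℝ) : Prop :=
  ∀ S : Set V, S.Nonempty → (∀ x ∈ S, ∀ y, 0 < q x y → y ∈ S) → S = Set.univ

/-- The maximum principle for subharmonic functions. -/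
theorem maximum_principle {q : V → V → ℝ} (hq : ∀ x y, 0 ≤ q x y) (hirr : IsIrreducible q)
    {D : Set V} (hD : D.Nonempty) {f : V → ℝ} (hfD : ∀ x ∈ D, f x ≤ 0)
    (hf : ∀ x ∉ D, 0 ≤ ∑ y, q x y * (f y - f x)) (x : V) : f x ≤ 0 := by
  obtain ⟨d, hd⟩ := hD
  have : Nonempty V := ⟨d⟩
  obtain ⟨x₀, hx₀⟩ := Finite.exists_max f
  refine (hx₀ x).trans ?_
  by_contra! hpos
  -- At a maximum off `D` the generator sum has only nonpositive terms, so each vanishes and the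
  -- maximum spreads along positive rates until it reaches `D`.
  have hS : {x | f x = f x₀} = Set.univ := by
    refine hirr _ ⟨x₀, rfl⟩ fun z hz y hzy => ?_
    have hz' : f z = f x₀ := hz
    have hzD : z ∉ D := fun h => by linarith [hfD z h]
    have h0 : ∀ y ∈ Finset.univ, q z y * (f y - f z) ≤ 0 := fun y _ =>
      mul_nonpos_of_nonneg_of_nonpos (hq z y) (by linarith [hx₀ y])
    have h1 := (Finset.sum_eq_zero_iff_of_nonpos h0).1
      (le_antisymm (Finset.sum_nonpos h0) (hf z hzD)) y (Finset.mem_univ y)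
    rcases mul_eq_zero.1 h1 with h | h
    · exact absurd h hzy.ne'
    · show f y = f x₀
      linarith
  have : f d = f x₀ := by
    have : d ∈ {x | f x = f x₀} := hS ▸ Set.mem_univ d
    exact this
  linarith [hfD d hd]

/-- Kato's inequality. -/
theorem sum_mul_norm_sub_norm_ge {q : V → V → ℝ} (hq : ∀ x y, 0 ≤ q x y) (f : V → ℂ) (x : V) :
    ‖((∑ y, q x y : ℝ) : ℂ) * f x + ∑ y, (q x y : ℂ) * (f y - f x)‖ - (∑ y, q x y) * ‖f x‖ ≤
      ∑ y, q x y * (‖f y‖ - ‖f x‖) := by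
  have h : ((∑ y, q x y : ℝ) : ℂ) * f x + ∑ y, (q x y : ℂ) * (f y - f x) =
      ∑ y, (q x y : ℂ) * f y := by
    push_cast
    rw [Finset.sum_mul, ← Finset.sum_add_distrib]
    exact Finset.sum_congr rfl fun y _ => by ring
  have h2 : ‖∑ y, (q x y : ℂ) * f y‖ ≤ ∑ y, q x y * ‖f y‖ := by
    refine (norm_sum_le _ _).trans (Finset.sum_le_sum fun y _ => ?_)
    rw [norm_mul, Complex.norm_real, Real.norm_of_nonneg (hq x y)]
  simp only [mul_sub, Finset.sum_sub_distrib, ← Finset.sum_mul] at h h2 ⊢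
  rw [h]
  linarith

/-- A function satisfying `L f = -i l f` off `D` is bounded by its supremum on `D`. -/
theorem norm_le_of_eigen {q : V → V → ℝ} (hq : ∀ x y, 0 ≤ q x y) (hirr : IsIrreducible q)
    {D : Set V} (hD : D.Nonempty) {f : V → ℂ} {C : ℝ} (hfD : ∀ x ∈ D, ‖f x‖ ≤ C) {l : ℝ}
    (hf : ∀ x ∉ D, ∑ y, (q x y : ℂ) * (f y - f x) + Complex.I * l * f x = 0) (x : V) :
    ‖f x‖ ≤ C := by
  refine sub_nonpos.1 (maximum_principle hq hirr hD (f := fun x => ‖f x‖ - C)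
    (fun x hx => sub_nonpos.2 (hfD x hx)) (fun x hx => ?_) x)
  have h1 := sum_mul_norm_sub_norm_ge hq f x
  have h2 : ((∑ y, q x y : ℝ) : ℂ) * f x + ∑ y, (q x y : ℂ) * (f y - f x) =
      ((∑ y, q x y : ℝ) - Complex.I * l) * f x := by
    linear_combination hf x hx
  -- An imaginary shift of the total rate can only increase its modulus; with Kato's inequality this
  -- makes `‖f‖` subharmonic off `D`.
  have h3 : (∑ y, q x y) ≤ ‖((∑ y, q x y : ℝ) - Complex.I * l : ℂ)‖ := by
    refine le_trans (le_of_eq ?_) (Complex.re_le_norm _)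
    simp
  rw [h2, norm_mul] at h1
  have h4 := mul_le_mul_of_nonneg_right h3 (norm_nonneg (f x))
  simp only [sub_sub_sub_cancel_right]
  linarith

/-- The Dirichlet problem `L f + i l f = k` off `D`, `f = 0` on `D`. -/
theorem exists_dirichlet {q : V → V → ℝ} (hq : ∀ x y, 0 ≤ q x y) (hirr : IsIrreducible q)
    {D : Set V} (hD : D.Nonempty) (l : ℝ) (k : V → ℂ) :
    ∃ f : V → ℂ, (∀ x ∈ D, f x = 0) ∧
      ∀ x ∉ D, ∑ y, (q x y : ℂ) * (f y - f x) + Complex.I * l * f x = k x := by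
  classical
  -- The boundary condition is built into a square linear system, so uniqueness (the previous bound
  -- with `C = 0`) gives existence.
  let T : (V → ℂ) →ₗ[ℂ] (V → ℂ) :=
    { toFun := fun f x => if x ∈ D then f x else
        ∑ y, (q x y : ℂ) * (f y - f x) + Complex.I * l * f x
      map_add' := fun f g => by
        ext x
        by_cases hx : x ∈ D
        · simp [hx]
        · simp only [hx, if_false, Pi.add_apply]
          have : ∀ y, (q x y : ℂ) * (f y + g y - (f x + g x)) =
            q x y * (f y - f x) + q x y * (g y - g x) := fun y => by ring
          simp only [this, Finset.sum_add_distrib]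
          ring
      map_smul' := fun c f => by
        ext x
        by_cases hx : x ∈ D
        · simp [hx]
        · simp only [hx, if_false, Pi.smul_apply, smul_eq_mul, RingHom.id_apply, mul_add,
            Finset.mul_sum]
          congr 1
          · exact Finset.sum_congr rfl fun y _ => by ring
          · ring }
  have hT : ∀ f x, T f x = if x ∈ D then f x else
        ∑ y, (q x y : ℂ) * (f y - f x) + Complex.I * l * f x := fun _ _ => rfl
  have hinj : Function.Injective T := by
    rw [← LinearMap.ker_eq_bot, LinearMap.ker_eq_bot']
    intro f hf
    have h0 : ∀ x, T f x = 0 := fun x => by rw [hf]; rfl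
    ext x
    refine norm_le_zero_iff.1 (norm_le_of_eigen hq hirr hD (l := l) (fun x hx => ?_)
      (fun x hx => ?_) x)
    · have := h0 x
      rw [hT, if_pos hx] at this
      simp [this]
    · have := h0 x
      rwa [hT, if_neg hx] at this
  obtain ⟨f, hf⟩ := LinearMap.injective_iff_surjective.1 hinj (fun x => if x ∈ D then 0 else k x)
  refine ⟨f, fun x hx => ?_, fun x hx => ?_⟩
  · have := congrFun hf x
    rwa [hT, if_pos hx, if_pos hx] at this
  · have := congrFun hf x
    rwa [hT, if_neg hx, if_neg hx] at this

/-- The real Dirichlet problem `L f = k` off `D`, `f = 0` on `D`. -/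
theorem exists_dirichlet_real {q : V → V → ℝ} (hq : ∀ x y, 0 ≤ q x y) (hirr : IsIrreducible q)
    {D : Set V} (hD : D.Nonempty) (k : V → ℝ) :
    ∃ f : V → ℝ, (∀ x ∈ D, f x = 0) ∧ ∀ x ∉ D, ∑ y, q x y * (f y - f x) = k x := by
  obtain ⟨f, h0, h1⟩ := exists_dirichlet hq hirr hD 0 (fun x => (k x : ℂ))
  refine ⟨fun x => (f x).re, fun x hx => by simp [h0 x hx], fun x hx => ?_⟩
  have := congrArg Complex.re (h1 x hx)
  simpa using this

/-- Reversibility makes the generator symmetric. -/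
theorem sum_mul_generator_comm {q : V → V → ℝ} {m : V → ℝ}
    (hrev : ∀ x y, m x * q x y = m y * q y x) (f g : V → ℂ) :
    ∑ x, (m x : ℂ) * g x * ∑ y, (q x y : ℂ) * (f y - f x) =
      ∑ x, (m x : ℂ) * f x * ∑ y, (q x y : ℂ) * (g y - g x) := by
  have hrev' : ∀ x y, (m x : ℂ) * q x y = m y * q y x := fun x y => by exact_mod_cast hrev x y
  have h : ∑ x, ∑ y, (m x : ℂ) * q x y * (g x * f y) =
      ∑ x, ∑ y, (m x : ℂ) * q x y * (f x * g y) := by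
    rw [Finset.sum_comm]
    exact Finset.sum_congr rfl fun x _ => Finset.sum_congr rfl fun y _ => by
      rw [hrev' y x]; ring
  have e : ∀ f g : V → ℂ, ∑ x, (m x : ℂ) * g x * ∑ y, (q x y : ℂ) * (f y - f x) =
      ∑ x, ∑ y, (m x : ℂ) * q x y * (g x * f y) -
        ∑ x, ∑ y, (m x : ℂ) * q x y * (g x * f x) := fun f g => by
    rw [← Finset.sum_sub_distrib]
    refine Finset.sum_congr rfl fun x _ => ?_
    rw [Finset.mul_sum, ← Finset.sum_sub_distrib]
    exact Finset.sum_congr rfl fun y _ => by ring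
  rw [e f g, e g f, h]
  congr 1
  exact Finset.sum_congr rfl fun x _ => Finset.sum_congr rfl fun y _ => by ring

/-! ### Green functions and flows. -/

/-- `g` is the Green function with pole `a` of the dynamics with rates `q` killed on `D`. -/
structure IsGreen [DecidableEq V] (q : V → V → ℝ) (D : Set V) (a : V) (g : V → ℝ) : Prop where
  zero : ∀ x ∈ D, g x = 0
  eq : ∀ x ∉ D, ∑ y, q x y * (g y - g x) = -(if x = a then 1 else 0)

namespace IsGreen

variable [DecidableEq V] {q : V → V → ℝ} {D : Set V} {a : V} {g : V → ℝ}

theorem nonneg (hg : IsGreen q D a g) (hq : ∀ x y, 0 ≤ q x y) (hirr : IsIrreducible q)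
    (hD : D.Nonempty) (x : V) : 0 ≤ g x := by
  refine neg_nonpos.1 (maximum_principle hq hirr hD (f := fun x => -g x)
    (fun x hx => by simp [hg.zero x hx]) (fun x hx => ?_) x)
  have h := hg.eq x hx
  have e : ∀ y, q x y * (-g y - -g x) = -(q x y * (g y - g x)) := fun y => by ring
  simp only [e, Finset.sum_neg_distrib, h]
  split_ifs <;> simp

/-- Off `D` the function `g` is harmonic except at `a`, so the maximum principle applies with `a`
adjoined to the boundary. -/
theorem le_pole (hg : IsGreen q D a g) (hq : ∀ x y, 0 ≤ q x y) (hirr : IsIrreducible q)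
    (hD : D.Nonempty) (x : V) : g x ≤ g a := by
  refine sub_nonpos.1 (maximum_principle hq hirr (D := insert a D) (Set.insert_nonempty a D)
    (f := fun x => g x - g a) (fun x hx => ?_) (fun x hx => ?_) x)
  · rcases hx with rfl | hx
    · simp
    · simpa [hg.zero x hx] using hg.nonneg hq hirr hD a
  · simp only [Set.mem_insert_iff, not_or] at hx
    simp only [sub_sub_sub_cancel_right]
    rw [hg.eq x hx.2, if_neg hx.1]
    simp

/-- The representation of the solution of a Dirichlet problem by the Green function. -/
theorem sum_mul_eq (hg : IsGreen q D a g) (haD : a ∉ D) {m : V → ℝ}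
    (hrev : ∀ x y, m x * q x y = m y * q y x) {f k : V → ℂ} (hf0 : ∀ x ∈ D, f x = 0)
    (hf : ∀ x ∉ D, ∑ y, (q x y : ℂ) * (f y - f x) = k x) :
    ∑ x, (m x : ℂ) * g x * k x = -(m a * f a) := by
  -- Symmetry moves the generator from `f` onto `g`, where it leaves only the unit mass at the pole.
  have h := sum_mul_generator_comm hrev f (fun x => (g x : ℂ))
  have h1 : ∑ x, (m x : ℂ) * g x * ∑ y, (q x y : ℂ) * (f y - f x) =
      ∑ x, (m x : ℂ) * g x * k x := by
    refine Finset.sum_congr rfl fun x _ => ?_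
    by_cases hx : x ∈ D
    · simp [hg.zero x hx]
    · rw [hf x hx]
  rw [← h1, h, Finset.sum_eq_single a]
  · have := hg.eq a haD
    rw [if_pos rfl] at this
    have h2 : ∑ y, (q a y : ℂ) * ((g y : ℂ) - g a) = -1 := by exact_mod_cast this
    rw [h2]; ring
  · intro x _ hx
    by_cases hxD : x ∈ D
    · simp [hf0 x hxD]
    · have := hg.eq x hxD
      rw [if_neg hx] at this
      have h2 : ∑ y, (q x y : ℂ) * ((g y : ℂ) - g x) = 0 := by
        rw [neg_zero] at this; exact_mod_cast this
      rw [h2, mul_zero]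
  · simp

/-- The total flow through the boundary of a set disjoint from `D` that contains the pole. -/
theorem sum_boundary (hg : IsGreen q D a g) {m : V → ℝ}
    (hrev : ∀ x y, m x * q x y = m y * q y x) {S : Finset V} (haS : a ∈ S)
    (hSD : ∀ x ∈ S, x ∉ D) :
    ∑ x ∈ S, ∑ y ∈ Sᶜ, m x * q x y * (g x - g y) = m a := by
  have h1 : ∑ x ∈ S, ∑ y, m x * q x y * (g x - g y) = m a := by
    have : ∀ x ∈ S, ∑ y, m x * q x y * (g x - g y) = if x = a then m a else 0 := by
      intro x hx
      have := hg.eq x (hSD x hx)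
      have e : ∑ y, m x * q x y * (g x - g y) = -(m x * ∑ y, q x y * (g y - g x)) := by
        rw [Finset.mul_sum, ← Finset.sum_neg_distrib]
        exact Finset.sum_congr rfl fun y _ => by ring
      rw [e, this]
      split_ifs with h <;> simp [h]
    rw [Finset.sum_congr rfl this]
    simp [haS]
  -- Internal flows cancel in pairs: the flow is antisymmetric by reversibility.
  have h2 : ∑ x ∈ S, ∑ y ∈ S, m x * q x y * (g x - g y) = 0 := by
    have h3 : ∑ x ∈ S, ∑ y ∈ S, m x * q x y * (g x - g y) =
        -∑ x ∈ S, ∑ y ∈ S, m x * q x y * (g x - g y) := by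
      conv_lhs => rw [Finset.sum_comm]
      rw [← Finset.sum_neg_distrib]
      refine Finset.sum_congr rfl fun x _ => ?_
      rw [← Finset.sum_neg_distrib]
      exact Finset.sum_congr rfl fun y _ => by rw [hrev y x]; ring
    linarith
  have h3 : ∑ x ∈ S, ∑ y, m x * q x y * (g x - g y) =
      ∑ x ∈ S, ∑ y ∈ S, m x * q x y * (g x - g y) +
        ∑ x ∈ S, ∑ y ∈ Sᶜ, m x * q x y * (g x - g y) := by
    rw [← Finset.sum_add_distrib]
    exact Finset.sum_congr rfl fun x _ => (Finset.sum_add_sum_compl S _).symm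
  linarith

/-- The flow through a single edge is at most the total flow. -/
theorem edge_flow_le (hg : IsGreen q D a g) (hq : ∀ x y, 0 ≤ q x y) (hirr : IsIrreducible q)
    (hD : D.Nonempty) {m : V → ℝ} (hm : ∀ x, 0 ≤ m x)
    (hrev : ∀ x y, m x * q x y = m y * q y x) (x y : V) :
    m x * q x y * (g x - g y) ≤ m a := by
  rcases le_or_gt (g x) (g y) with hxy | hxy
  · exact (mul_nonpos_of_nonneg_of_nonpos (mul_nonneg (hm x) (hq x y)) (by linarith)).trans (hm a)
  -- Every edge leaving this superlevel set carries nonnegative flow, so a single one carries at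
  -- most the total. The set contains the pole, where `g` is maximal, and misses `D`, where `g`
  -- vanishes.
  · set S : Finset V := Finset.univ.filter fun z => g y < g z with hS
    have hflow := hg.sum_boundary hrev (S := S)
      (by simpa [hS] using hxy.trans_le (hg.le_pole hq hirr hD x))
      (fun z hz hzD => by
        have : g y < g z := by simpa [hS] using hz
        linarith [hg.zero z hzD, hg.nonneg hq hirr hD y])
    have hterm : ∀ z ∈ S, ∀ w ∈ Sᶜ, 0 ≤ m z * q z w * (g z - g w) := by
      intro z hz w hw
      have h1 : g y < g z := by simpa [hS] using hz
      have h2 : g w ≤ g y := by simpa [hS] using hw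
      exact mul_nonneg (mul_nonneg (hm z) (hq z w)) (by linarith)
    have hxS : x ∈ S := by simpa [hS] using hxy
    have hyS : y ∈ Sᶜ := by simp [hS]
    calc m x * q x y * (g x - g y) ≤ ∑ w ∈ Sᶜ, m x * q x w * (g x - g w) :=
          Finset.single_le_sum (f := fun w => m x * q x w * (g x - g w)) (hterm x hxS) hyS
      _ ≤ ∑ z ∈ S, ∑ w ∈ Sᶜ, m z * q z w * (g z - g w) :=
          Finset.single_le_sum (f := fun z => ∑ w ∈ Sᶜ, m z * q z w * (g z - g w))
            (fun z hz => Finset.sum_nonneg (hterm z hz)) hxS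
      _ = m a := hflow

/-- A lower bound for the Green function at the pole, in terms of the conductances through the
boundary of a set. -/
theorem le_mul_pole (hg : IsGreen q D a g) (hq : ∀ x y, 0 ≤ q x y) (hirr : IsIrreducible q)
    (hD : D.Nonempty) {m : V → ℝ} (hm : ∀ x, 0 ≤ m x)
    (hrev : ∀ x y, m x * q x y = m y * q y x) {S : Set V} (haS : a ∈ S)
    (hSD : ∀ x ∈ S, x ∉ D) {c : ℝ} (hc : 0 ≤ c) (hcS : ∀ x ∈ S, ∀ y ∉ S, m x * q x y ≤ c) :
    m a ≤ (Fintype.card V) ^ 2 * c * g a := by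
  classical
  set S' : Finset V := Finset.univ.filter (· ∈ S)
  have hflow := hg.sum_boundary hrev (S := S') (by simpa [S'] using haS)
    (fun x hx => hSD x (by simpa [S'] using hx))
  have hga := hg.nonneg hq hirr hD a
  rw [← hflow]
  have h1 : ∀ x ∈ S', ∀ y ∈ S'ᶜ, m x * q x y * (g x - g y) ≤ c * g a := by
    intro x hx y hy
    have hc' := hcS x (by simpa [S'] using hx) y (by simpa [S'] using hy)
    calc m x * q x y * (g x - g y) ≤ m x * q x y * g a :=
          mul_le_mul_of_nonneg_left
            (by linarith [hg.le_pole hq hirr hD x, hg.nonneg hq hirr hD y])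
            (mul_nonneg (hm x) (hq x y))
      _ ≤ c * g a := mul_le_mul_of_nonneg_right hc' hga
  calc ∑ x ∈ S', ∑ y ∈ S'ᶜ, m x * q x y * (g x - g y)
      ≤ ∑ x ∈ S', ∑ y ∈ S'ᶜ, c * g a :=
        Finset.sum_le_sum fun x hx => Finset.sum_le_sum fun y hy => h1 x hx y hy
    _ ≤ ∑ x : V, ∑ y : V, c * g a :=
        (Finset.sum_le_sum fun x _ => Finset.sum_le_sum_of_subset_of_nonneg (Finset.subset_univ _)
          fun _ _ _ => mul_nonneg hc hga).trans
          (Finset.sum_le_sum_of_subset_of_nonneg (Finset.subset_univ _)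
            fun _ _ _ => Finset.sum_nonneg fun _ _ => mul_nonneg hc hga)
    _ = (Fintype.card V) ^ 2 * c * g a := by
        simp only [Finset.sum_const, Finset.card_univ, nsmul_eq_mul]
        ring

end IsGreen

end Dirichlet

/-! ### Communication heights and the cycles of the landscape. -/

section HeightLemmas

variable {V : Type*} {G : SimpleGraph V} (H : V → ℝ)

theorem height_le_iff {x y : V} (p : G.Walk x y) {c : ℝ} :
    height H p ≤ c ↔ ∀ z ∈ p.support, H z ≤ c := by
  induction p with
  | nil => simp [height]
  | cons h p ih => simp [height, ih]

theorem height_lt_iff {x y : V} (p : G.Walk x y) {c : ℝ} :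
    height H p < c ↔ ∀ z ∈ p.support, H z < c := by
  induction p with
  | nil => simp [height]
  | cons h p ih => simp [height, ih]

theorem height_mem_range {x y : V} (p : G.Walk x y) : height H p ∈ Set.range H := by
  induction p with
  | nil => exact ⟨_, rfl⟩
  | @cons u v w h p ih =>
    rcases max_choice (H u) (height H p) with h | h
    · exact ⟨u, h.symm⟩
    · rw [height, h]; exact ih

variable [Finite V]

theorem finite_range_height (x y : V) :
    (Set.range fun p : G.Walk x y => height H p).Finite :=
  (Set.finite_range H).subset (by rintro _ ⟨p, rfl⟩; exact height_mem_range H p)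

theorem commHeight_le {x y : V} (p : G.Walk x y) : commHeight G H x y ≤ height H p :=
  ciInf_le (finite_range_height H x y).bddBelow p

theorem exists_height_eq_commHeight (hG : G.Connected) (x y : V) :
    ∃ p : G.Walk x y, height H p = commHeight G H x y := by
  have : Nonempty (G.Walk x y) := hG.preconnected x y
  exact (Set.range_nonempty _).csInf_mem (finite_range_height H x y)

theorem le_commHeight_left (hG : G.Connected) (x y : V) : H x ≤ commHeight G H x y := by
  obtain ⟨p, hp⟩ := exists_height_eq_commHeight H hG x y
  rw [← hp]
  exact (height_le_iff H p).1 le_rfl x p.start_mem_support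

variable {H} {a b : V} {gate : Set V}

/-- Otherwise the trivial path is optimal, so `a` lies in the gate. But (P4) provides a path from
`a` staying strictly below the gate, a contradiction at its starting point. -/
theorem IsMetastable.ne (hG : G.Connected) (h : IsMetastable G H a b gate) : a ≠ b := by
  rintro rfl
  have h1 : height H (SimpleGraph.Walk.nil : G.Walk a a) = commHeight G H a a :=
    le_antisymm (le_commHeight_left H hG a a) (commHeight_le H _)
  obtain ⟨g, hg, hgate, -⟩ := h.gate_property _ h1
  obtain rfl : g = a := by simpa using hg
  obtain ⟨-, x, ⟨p, hp⟩, -⟩ := h.gate_subset hgate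
  exact lt_irrefl _ (hp g p.start_mem_support g hgate)

/-- This is (P2) at `x = b`, whose own barrier is nonnegative. -/
theorem IsMetastable.barrier_pos (hG : G.Connected) (h : IsMetastable G H a b gate) :
    0 < barrier G H a b := by
  have h1 := h.metastable b (h.ne hG).symm
  have h2 := le_commHeight_left H hG b b
  rw [barrier] at h1
  linarith

/-- An optimal path meets the gate at its maximum, so the gate is nonempty and its common energy is
the communication height. -/
theorem IsMetastable.belowGate_eq (hG : G.Connected) (h : IsMetastable G H a b gate) :
    belowGate H gate = {x | H x < commHeight G H a b} := by
  obtain ⟨p, hp⟩ := exists_height_eq_commHeight H hG a b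
  obtain ⟨g, -, hg, hgp⟩ := h.gate_property p hp
  rw [hp] at hgp
  ext x
  refine ⟨fun hx => hgp ▸ hx g hg, fun hx g' hg' => ?_⟩
  rw [h.gate_energy g' hg' g hg, hgp]
  exact hx

/-- The cycle of `a` is disjoint from the target, in both cases of the theorem. -/
theorem IsMetastable.target (hG : G.Connected) (h : IsMetastable G H a b gate) {D : Set V}
    (hD : D = {b} ∨ D = cycleOf G H gate b) :
    b ∈ D ∧ ∀ x ∈ cycleOf G H gate a, x ∉ D := by
  have hab := h.barrier_pos hG
  have hne := h.ne hG
  rw [barrier] at hab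
  have hb : H b < commHeight G H a b := by linarith [h.fundamental a hne]
  have hbb : b ∈ cycleOf G H gate b := by
    refine ⟨.nil, fun z hz => ?_⟩
    obtain rfl : z = b := by simpa using hz
    rw [h.belowGate_eq hG]; exact hb
  -- A common point would join `a` to `b` by a path strictly below the communication height.
  have hdisj : ∀ x ∈ cycleOf G H gate a, x ∉ cycleOf G H gate b := by
    rintro x ⟨p, hp⟩ ⟨r, hr⟩
    rw [h.belowGate_eq hG] at hp hr
    have : height H (p.append r.reverse) < commHeight G H a b := by
      rw [height_lt_iff]
      intro z hz
      rw [SimpleGraph.Walk.mem_support_append_iff, SimpleGraph.Walk.support_reverse,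
        List.mem_reverse] at hz
      exact hz.elim (hp z) (hr z)
    exact (commHeight_le H _).not_gt this
  rcases hD with rfl | rfl
  · exact ⟨rfl, fun x hx hxb => hdisj x hx (by rwa [Set.mem_singleton_iff.1 hxb])⟩
  · exact ⟨hbb, hdisj⟩

theorem IsMetastable.mem_cycleOf (hG : G.Connected) (h : IsMetastable G H a b gate) :
    a ∈ cycleOf G H gate a := by
  have hab := h.barrier_pos hG
  rw [barrier] at hab
  refine ⟨.nil, fun z hz => ?_⟩
  obtain rfl : z = a := by simpa using hz
  rw [h.belowGate_eq hG]
  show H z < _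
  linarith

/-- Leaving the cycle of `a` requires climbing to the communication height. -/
theorem IsMetastable.commHeight_le_of_leaves (hG : G.Connected) (h : IsMetastable G H a b gate)
    {x y : V} (hx : x ∈ cycleOf G H gate a) (hy : y ∉ cycleOf G H gate a) (hxy : G.Adj x y) :
    commHeight G H a b ≤ H y := by
  by_contra! hlt
  obtain ⟨p, hp⟩ := hx
  refine hy ⟨p.concat hxy, fun z hz => ?_⟩
  rw [SimpleGraph.Walk.support_concat, List.mem_append, List.mem_singleton] at hz
  rcases hz with hz | rfl
  · exact hp z hz
  · rw [h.belowGate_eq hG]; exact hlt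

end HeightLemmas

/-! ### Green function asymptotics and the characteristic function estimate. -/

section Rates

variable {V : Type*} {G : SimpleGraph V} [DecidableRel G.Adj] {H : V → ℝ} {β : ℝ}

theorem rate_nonneg (x y : V) : 0 ≤ rate G H β x y := by
  rw [rate]; split_ifs <;> positivity

/-- The conductances of the Metropolis dynamics. -/
theorem exp_mul_rate (x y : V) : Real.exp (-β * H x) * rate G H β x y =
    if G.Adj x y then Real.exp (-β * max (H x) (H y)) else 0 := by
  rw [rate]
  split_ifs
  · rw [← Real.exp_add, ← mul_add, ← max_add_add_left]
    congr 2
    rw [max_comm]; congr 1 <;> ring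
  · simp

theorem rate_reversible (x y : V) : Real.exp (-β * H x) * rate G H β x y =
    Real.exp (-β * H y) * rate G H β y x := by
  simp only [exp_mul_rate, max_comm (H x), G.adj_comm x]

theorem isIrreducible_rate (hG : G.Connected) : IsIrreducible (rate G H β) := by
  rintro S ⟨x, hx⟩ hS
  refine Set.eq_univ_of_forall fun y => ?_
  obtain ⟨p⟩ := hG.preconnected x y
  induction p with
  | nil => exact hx
  | @cons u v w h p ih =>
    refine ih (hS u hx v ?_)
    rw [rate, if_pos h]
    positivity

variable [Fintype V] [DecidableEq V] {a b : V} {D : Set V} {g : V → ℝ}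

/-- Since an edge carries flow at most `exp (-β * H a)`, the drop of `g` across it is at most that
divided by its conductance; the drops telescope down to the value `0` on `D`. -/
theorem IsGreen.le_of_walk (hg : IsGreen (rate G H β) D a g) (hG : G.Connected) (hβ : 0 ≤ β)
    {x y : V} (hy : y ∈ D) (p : G.Walk x y) :
    g x ≤ p.length * (Real.exp (β * height H p) * Real.exp (-β * H a)) := by
  induction p with
  | nil => simp [hg.zero _ hy]
  | @cons u v w h p ih =>
    have h1 := hg.edge_flow_le rate_nonneg (isIrreducible_rate hG) ⟨w, hy⟩
      (m := fun x => Real.exp (-β * H x)) (fun _ => (Real.exp_pos _).le) rate_reversible u v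
    simp only [exp_mul_rate, if_pos h] at h1
    have hv : H v ≤ height H p := (height_le_iff H p).1 le_rfl v p.start_mem_support
    have h2 : g u - g v ≤ Real.exp (β * max (H u) (H v)) * Real.exp (-β * H a) := by
      calc g u - g v = Real.exp (β * max (H u) (H v)) *
            (Real.exp (-β * max (H u) (H v)) * (g u - g v)) := by
            rw [← mul_assoc, ← Real.exp_add]; simp
        _ ≤ _ := mul_le_mul_of_nonneg_left h1 (Real.exp_pos _).le
    have h3 : Real.exp (β * max (H u) (H v)) ≤ Real.exp (β * height H (.cons h p)) :=
      Real.exp_le_exp.2 (mul_le_mul_of_nonneg_left (max_le_max le_rfl hv) hβ)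
    have h4 : Real.exp (β * height H p) ≤ Real.exp (β * height H (.cons h p)) :=
      Real.exp_le_exp.2 (mul_le_mul_of_nonneg_left (le_max_right _ _) hβ)
    have h5 := (Real.exp_pos (-β * H a)).le
    have h6 := mul_le_mul_of_nonneg_right h3 h5
    have h7 := mul_le_mul_of_nonneg_left (mul_le_mul_of_nonneg_right h4 h5)
      (Nat.cast_nonneg (α := ℝ) p.length)
    rw [SimpleGraph.Walk.length_cons]
    push_cast
    linarith [ih hy]

variable {gate : Set V}

/-- The cut is the cycle of `a`: an exit edge climbs at least to the communication height, which
caps its conductance. -/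
theorem IsMetastable.exp_le_green_pole (h : IsMetastable G H a b gate) (hG : G.Connected)
    (hβ : 0 ≤ β) (hD : D = {b} ∨ D = cycleOf G H gate b) (hg : IsGreen (rate G H β) D a g) :
    Real.exp (-β * H a) ≤
      (Fintype.card V) ^ 2 * Real.exp (-β * commHeight G H a b) * g a := by
  obtain ⟨hb, hdisj⟩ := h.target hG hD
  refine hg.le_mul_pole rate_nonneg (isIrreducible_rate hG) ⟨b, hb⟩
    (m := fun x => Real.exp (-β * H x)) (fun _ => (Real.exp_pos _).le) rate_reversible
    (h.mem_cycleOf hG) hdisj (Real.exp_pos _).le (fun x hx y hy => ?_)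
  simp only [exp_mul_rate]
  split_ifs with hxy
  · refine Real.exp_le_exp.2 (mul_le_mul_of_nonpos_left ?_ (neg_nonpos.2 hβ))
    exact (h.commHeight_le_of_leaves hG hx hy hxy).trans (le_max_right _ _)
  · positivity

theorem IsMetastable.green_pole_pos (h : IsMetastable G H a b gate) (hG : G.Connected)
    (hβ : 0 ≤ β) (hD : D = {b} ∨ D = cycleOf G H gate b) (hg : IsGreen (rate G H β) D a g) :
    0 < g a := by
  by_contra! hle
  have h1 := h.exp_le_green_pole hG hβ hD hg
  have h2 := Real.exp_pos (-β * H a)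
  have : (Fintype.card V : ℝ) ^ 2 * Real.exp (-β * commHeight G H a b) * g a ≤ 0 :=
    mul_nonpos_of_nonneg_of_nonpos (by positivity) hle
  linarith

/-- Before reaching the target, the chain started from `a` spends nearly all its time at `a`. -/
theorem IsMetastable.exists_green_decay (h : IsMetastable G H a b gate) (hG : G.Connected)
    (hD : D = {b} ∨ D = cycleOf G H gate b) :
    ∃ C δ : ℝ, 0 < δ ∧ ∀ β : ℝ, 0 ≤ β → ∀ g : V → ℝ, IsGreen (rate G H β) D a g → ∀ x ≠ a,
      Real.exp (-β * H x) * g x ≤ C * Real.exp (-β * δ) * (Real.exp (-β * H a) * g a) := by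
  obtain ⟨hb, -⟩ := h.target hG hD
  choose p hp using fun x => exists_height_eq_commHeight H hG x b
  set C : V → ℝ := fun x => (Fintype.card V) ^ 2 * (p x).length
  set δ : V → ℝ := fun x => if x = a then 1 else barrier G H a b - barrier G H x b
  have hδpos : ∀ x, 0 < δ x := fun x => by
    simp only [δ]
    split_ifs with hx
    · exact one_pos
    · exact sub_pos.2 (h.metastable x hx)
  have : Nonempty V := ⟨a⟩
  obtain ⟨x₀, hx₀⟩ := Finite.exists_min δ
  have hC : ∀ x, 0 ≤ C x := fun x => by positivity
  refine ⟨∑ x, C x, δ x₀, hδpos x₀, fun β hβ g hg x hx => ?_⟩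
  have hga := h.green_pole_pos hG hβ hD hg
  have h1 := hg.le_of_walk hG hβ hb (p x)
  have h2 := h.exp_le_green_pole hG hβ hD hg
  rw [hp] at h1
  have hδx : δ x = barrier G H a b - barrier G H x b := if_neg hx
  -- The lower bound on `g a` replaces the factor `exp (-β * H a)` in the path bound on `g x`; the
  -- exponents then combine into the difference of barriers.
  calc Real.exp (-β * H x) * g x
      ≤ Real.exp (-β * H x) * ((p x).length * (Real.exp (β * commHeight G H x b) *
          ((Fintype.card V) ^ 2 * Real.exp (-β * commHeight G H a b) * g a))) :=
        mul_le_mul_of_nonneg_left (h1.trans (by gcongr)) (Real.exp_pos _).le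
    _ = C x * Real.exp (-β * δ x) * (Real.exp (-β * H a) * g a) := by
        have : Real.exp (-β * δ x) * Real.exp (-β * H a) = Real.exp (-β * H x) *
            Real.exp (β * commHeight G H x b) * Real.exp (-β * commHeight G H a b) := by
          rw [← Real.exp_add, ← Real.exp_add, ← Real.exp_add, hδx, barrier, barrier]
          congr 1; ring
        simp only [C]
        linear_combination -((Fintype.card V : ℝ) ^ 2 * (p x).length * g a) * this
    _ ≤ (∑ x, C x) * Real.exp (-β * δ x₀) * (Real.exp (-β * H a) * g a) := by
        have e1 : C x ≤ ∑ x, C x := Finset.single_le_sum (fun y _ => hC y) (Finset.mem_univ x)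
        have e2 : Real.exp (-β * δ x) ≤ Real.exp (-β * δ x₀) :=
          Real.exp_le_exp.2 (mul_le_mul_of_nonpos_left (hx₀ x) (neg_nonpos.2 hβ))
        have e3 : 0 ≤ ∑ x, C x := Finset.sum_nonneg fun y _ => hC y
        gcongr

/-- The solution `T` of `L T = -1` off `D` is the total mass of the Green function. -/
theorem IsGreen.mul_mean_eq (hg : IsGreen (rate G H β) D a g) (haD : a ∉ D) {T : V → ℝ}
    (hT0 : ∀ x ∈ D, T x = 0) (hT : ∀ x ∉ D, ∑ y, rate G H β x y * (T y - T x) = -1) :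
    ∑ x, Real.exp (-β * H x) * g x = Real.exp (-β * H a) * T a := by
  have h1 := hg.sum_mul_eq haD (m := fun x => Real.exp (-β * H x)) rate_reversible
    (f := fun x => (T x : ℂ)) (k := fun _ => -1) (fun x hx => by simp [hT0 x hx])
    (fun x hx => by exact_mod_cast hT x hx)
  have h2 : ((∑ x, Real.exp (-β * H x) * g x : ℝ) : ℂ) =
      ((Real.exp (-β * H a) * T a : ℝ) : ℂ) := by
    push_cast at h1 ⊢
    simp only [mul_neg, mul_one, Finset.sum_neg_distrib] at h1
    exact neg_injective h1
  exact_mod_cast h2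

theorem IsMetastable.green_pole_le_mean (h : IsMetastable G H a b gate) (hG : G.Connected)
    (hD : D = {b} ∨ D = cycleOf G H gate b) (hg : IsGreen (rate G H β) D a g)
    {T : V → ℝ} (hT0 : ∀ x ∈ D, T x = 0)
    (hT : ∀ x ∉ D, ∑ y, rate G H β x y * (T y - T x) = -1) : g a ≤ T a := by
  obtain ⟨hb, hdisj⟩ := h.target hG hD
  have h1 := hg.mul_mean_eq (hdisj a (h.mem_cycleOf hG)) hT0 hT
  have h2 : Real.exp (-β * H a) * g a ≤ ∑ x, Real.exp (-β * H x) * g x :=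
    Finset.single_le_sum (f := fun x => Real.exp (-β * H x) * g x) (fun x _ => mul_nonneg
      (Real.exp_pos _).le (hg.nonneg rate_nonneg (isIrreducible_rate hG) ⟨b, hb⟩ x))
      (Finset.mem_univ a)
  rw [h1] at h2
  exact le_of_mul_le_mul_left h2 (Real.exp_pos _)

/-- The characteristic function `1 + ψ a` of the rescaled hitting time is close to that of the
exponential law. -/
theorem IsMetastable.exists_charFun_bound (h : IsMetastable G H a b gate) (hG : G.Connected)
    (hD : D = {b} ∨ D = cycleOf G H gate b) (u : ℝ) :
    ∃ C δ : ℝ, 0 < δ ∧ ∀ β : ℝ, 0 ≤ β → ∀ T : V → ℝ, (∀ x ∈ D, T x = 0) →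
      (∀ x ∉ D, ∑ y, rate G H β x y * (T y - T x) = -1) → 0 < T a ∧
      ∀ ψ : V → ℂ, (∀ x ∈ D, ψ x = 0) →
      (∀ x ∉ D, ∑ y, (rate G H β x y : ℂ) * (ψ y - ψ x) + Complex.I * (u / T a : ℝ) * ψ x =
        -(Complex.I * (u / T a : ℝ))) →
      ‖(1 + ψ a) * (1 - Complex.I * u) - 1‖ ≤ C * Real.exp (-β * δ) := by
  obtain ⟨C, δ, hδ, hdecay⟩ := h.exists_green_decay hG hD
  obtain ⟨hb, hdisj⟩ := h.target hG hD
  have haD := hdisj a (h.mem_cycleOf hG)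
  refine ⟨|u| * (∑ _x : V, 2 * |C|), δ, hδ, fun β hβ T hT0 hT => ?_⟩
  obtain ⟨g, hg0, hg1⟩ := exists_dirichlet_real (q := rate G H β) rate_nonneg
    (isIrreducible_rate hG) ⟨b, hb⟩ (fun x => -(if x = a then 1 else 0))
  have hg : IsGreen (rate G H β) D a g := ⟨hg0, hg1⟩
  have hga := h.green_pole_pos hG hβ hD hg
  have hgT := h.green_pole_le_mean hG hD hg hT0 hT
  have hTa : 0 < T a := hga.trans_le hgT
  refine ⟨hTa, fun ψ hψ0 hψ => ?_⟩
  have hg_nonneg := hg.nonneg rate_nonneg (isIrreducible_rate hG) ⟨b, hb⟩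
  set l : ℝ := u / T a with hl
  set m : V → ℝ := fun x => Real.exp (-β * H x) with hm
  have hmpos : ∀ x, 0 < m x := fun x => Real.exp_pos _
  have hu : u = l * T a := by rw [hl]; field_simp
  -- The function `1 + ψ` solves the homogeneous equation with boundary value `1`, so no
  -- probabilistic interpretation is needed here.
  have hφ : ∀ x, ‖1 + ψ x‖ ≤ 1 := by
    refine norm_le_of_eigen rate_nonneg (isIrreducible_rate (H := H) (β := β) hG) ⟨b, hb⟩
      (f := fun x => 1 + ψ x) (l := l) (fun x hx => by simp [hψ0 x hx]) (fun x hx => ?_)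
    have := hψ x hx
    simp only [add_sub_add_left_eq_sub]
    linear_combination this
  have h1 := hg.sum_mul_eq haD (m := m) rate_reversible (f := ψ)
    (k := fun x => -(Complex.I * l * (1 + ψ x))) hψ0
    (fun x hx => by linear_combination hψ x hx)
  have h2 : (∑ x, (m x : ℂ) * g x) = m a * T a := by
    exact_mod_cast hg.mul_mean_eq haD hT0 hT
  -- Subtracting `1 + ψ a` inside the Green representation of `ψ a` removes the dominant term `x =
  -- a`, leaving only the error.
  have h3 : (m a : ℂ) * ((1 + ψ a) * (1 - Complex.I * u) - 1) =
      Complex.I * l * ∑ x, (m x : ℂ) * g x * ((1 + ψ x) - (1 + ψ a)) := by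
    have e1 : ∑ x, (m x : ℂ) * g x * -(Complex.I * l * (1 + ψ x)) =
        -(Complex.I * l * ∑ x, (m x : ℂ) * g x * (1 + ψ x)) := by
      rw [Finset.mul_sum, ← Finset.sum_neg_distrib]
      exact Finset.sum_congr rfl fun x _ => by ring
    rw [e1] at h1
    have e2 : ∑ x, (m x : ℂ) * g x * ((1 + ψ x) - (1 + ψ a)) =
        ∑ x, (m x : ℂ) * g x * (1 + ψ x) - (∑ x, (m x : ℂ) * g x) * (1 + ψ a) := by
      rw [Finset.sum_mul, ← Finset.sum_sub_distrib]
      exact Finset.sum_congr rfl fun x _ => by ring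
    rw [e2, h2, hu]
    push_cast
    linear_combination h1
  have h4 : ‖∑ x, (m x : ℂ) * g x * ((1 + ψ x) - (1 + ψ a))‖ ≤
      (∑ _x : V, 2 * |C|) * (Real.exp (-β * δ) * (m a * g a)) := by
    refine (norm_sum_le _ _).trans ?_
    rw [Finset.sum_mul]
    refine Finset.sum_le_sum fun x _ => ?_
    by_cases hx : x = a
    · subst hx
      simp only [sub_self, mul_zero, norm_zero]
      have := hmpos x
      positivity
    · rw [norm_mul, norm_mul, Complex.norm_real, Complex.norm_real,
        Real.norm_of_nonneg (hmpos x).le, Real.norm_of_nonneg (hg_nonneg x)]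
      have e1 : ‖(1 + ψ x) - (1 + ψ a)‖ ≤ 2 :=
        (norm_sub_le _ _).trans (by linarith [hφ x, hφ a])
      have e2 : m x * g x ≤ |C| * Real.exp (-β * δ) * (m a * g a) := by
        refine (hdecay β hβ g hg x hx).trans ?_
        have := hmpos a
        gcongr
        exact le_abs_self C
      calc m x * g x * ‖(1 + ψ x) - (1 + ψ a)‖
          ≤ m x * g x * 2 :=
            mul_le_mul_of_nonneg_left e1 (mul_nonneg (hmpos x).le (hg_nonneg x))
        _ ≤ |C| * Real.exp (-β * δ) * (m a * g a) * 2 :=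
            mul_le_mul_of_nonneg_right e2 zero_le_two
        _ = _ := by ring
  have h5 := congrArg norm h3
  rw [norm_mul, norm_mul, norm_mul, Complex.norm_I, one_mul, Complex.norm_real,
    Complex.norm_real, Real.norm_of_nonneg (hmpos a).le, Real.norm_eq_abs] at h5
  -- This is why time is rescaled by `T a`: the large factor `g a` in the error is absorbed
  -- uniformly in `β`.
  have h6 : |l| * g a ≤ |u| := by
    rw [hu, abs_mul, abs_of_pos hTa]
    exact mul_le_mul_of_nonneg_left hgT (abs_nonneg _)
  refine le_of_mul_le_mul_left ?_ (hmpos a)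
  rw [h5]
  have hS : 0 ≤ ∑ _x : V, 2 * |C| := Finset.sum_nonneg fun _ _ => by positivity
  calc |l| * ‖∑ x, (m x : ℂ) * g x * ((1 + ψ x) - (1 + ψ a))‖
      ≤ |l| * ((∑ _x : V, 2 * |C|) * (Real.exp (-β * δ) * (m a * g a))) :=
        mul_le_mul_of_nonneg_left h4 (abs_nonneg _)
    _ = m a * ((|l| * g a) * (∑ _x : V, 2 * |C|) * Real.exp (-β * δ)) := by ring
    _ ≤ m a * (|u| * (∑ _x : V, 2 * |C|) * Real.exp (-β * δ)) := by
        have := hmpos a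
        gcongr

end Rates

/-! ### Chernoff's product formula in a Banach algebra. -/

section ProductFormula

variable {𝔸 : Type*} [NormedRing 𝔸]

theorem norm_pow_le_of_norm_one [NormOneClass 𝔸] {x : 𝔸} {R : ℝ} (hx : ‖x‖ ≤ R) (n : ℕ) :
    ‖x ^ n‖ ≤ R ^ n :=
  (norm_pow_le x n).trans (pow_le_pow_left₀ (norm_nonneg x) hx n)

/-- Telescoping would give the power `R ^ (n - 1)`; `1 ≤ R` allows the simpler `R ^ n`. -/
theorem norm_pow_sub_pow_le_mul [NormOneClass 𝔸] {x y : 𝔸} {R : ℝ} (hR : 1 ≤ R) (hx : ‖x‖ ≤ R)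
    (hy : ‖y‖ ≤ R) (n : ℕ) : ‖x ^ n - y ^ n‖ ≤ n * ‖x - y‖ * R ^ n := by
  have hR0 : 0 ≤ R := zero_le_one.trans hR
  induction n with
  | zero => simp
  | succ n ih =>
    have e : x ^ (n + 1) - y ^ (n + 1) = (x ^ n - y ^ n) * x + y ^ n * (x - y) := by
      rw [pow_succ, pow_succ]; noncomm_ring
    have h1 : ‖(x ^ n - y ^ n) * x‖ ≤ n * ‖x - y‖ * R ^ n * R :=
      (norm_mul_le _ _).trans (mul_le_mul ih hx (norm_nonneg _) (by positivity))
    have h2 : ‖y ^ n * (x - y)‖ ≤ R ^ n * ‖x - y‖ :=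
      (norm_mul_le _ _).trans
        (mul_le_mul_of_nonneg_right (norm_pow_le_of_norm_one hy n) (norm_nonneg _))
    have h3 : R ^ n * ‖x - y‖ ≤ R ^ (n + 1) * ‖x - y‖ :=
      mul_le_mul_of_nonneg_right (pow_le_pow_right₀ hR (Nat.le_succ n)) (norm_nonneg _)
    calc ‖x ^ (n + 1) - y ^ (n + 1)‖ ≤ n * ‖x - y‖ * R ^ n * R + R ^ n * ‖x - y‖ := by
          rw [e]; exact (norm_add_le _ _).trans (add_le_add h1 h2)
      _ ≤ n * ‖x - y‖ * R ^ n * R + R ^ (n + 1) * ‖x - y‖ := by gcongr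
      _ = (n + 1 : ℕ) * ‖x - y‖ * R ^ (n + 1) := by push_cast; ring

/-- Chernoff's product formula, for bounded generators. -/
theorem tendsto_pow_exp_of_hasDerivAt [NormOneClass 𝔸] [NormedAlgebra ℝ 𝔸] [NormedAlgebra ℚ 𝔸]
    [CompleteSpace 𝔸] {A : ℝ → 𝔸} {K : 𝔸} (h0 : A 0 = 1) (hA : HasDerivAt A K 0) (t : ℝ) :
    Tendsto (fun n : ℕ => A (t / n) ^ n) atTop (𝓝 (NormedSpace.exp (t • K))) := by
  have hB : HasDerivAt (fun s : ℝ => NormedSpace.exp (s • K)) K 0 := by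
    simpa using hasDerivAt_exp_smul_const K (0 : ℝ)
  set B : ℝ → 𝔸 := fun s => NormedSpace.exp (s • K) with hBdef
  have hB0 : B 0 = 1 := by simp [hBdef]
  have hs : Tendsto (fun n : ℕ => t / (n : ℝ)) atTop (𝓝 0) := tendsto_const_div_atTop_nhds_zero_nat t
  -- First-order expansion at `0`; this keeps `n`-th powers bounded by `exp ((‖K‖ + 1) * |t|)`.
  have growth : ∀ F : ℝ → 𝔸, F 0 = 1 → HasDerivAt F K 0 →
      ∀ᶠ n : ℕ in atTop, ‖F (t / n)‖ ≤ 1 + (‖K‖ + 1) * |t / n| := by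
    intro F hF0 hF
    have h1 := (hasDerivAt_iff_isLittleO_nhds_zero.1 hF).def one_pos
    filter_upwards [hs.eventually h1] with n hn
    simp only [zero_add, hF0, Real.norm_eq_abs, one_mul] at hn
    calc ‖F (t / n)‖ = ‖(F (t / n) - 1 - (t / n) • K) + 1 + (t / n) • K‖ := by
          congr 1; abel
      _ ≤ ‖F (t / n) - 1 - (t / n) • K‖ + ‖(1 : 𝔸)‖ + ‖(t / n) • K‖ := norm_add₃_le
      _ ≤ |t / n| + 1 + |t / n| * ‖K‖ := by
          rw [norm_one, norm_smul, Real.norm_eq_abs]; gcongr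
      _ = _ := by ring
  -- Both families have the same value and derivative at `0`, so they differ by `o(1 / n)`, which
  -- survives `n` telescoped factors.
  have hdiff : Tendsto (fun n : ℕ => (n : ℝ) * ‖A (t / n) - B (t / n)‖) atTop (𝓝 0) := by
    rw [Metric.tendsto_atTop']
    intro ε hε
    have h1 := (hasDerivAt_iff_isLittleO_nhds_zero.1 (hA.sub hB)).def
      (show 0 < ε / (|t| + 1) by positivity)
    obtain ⟨N, hN⟩ := eventually_atTop.1 (hs.eventually h1)
    refine ⟨N, fun n hn => ?_⟩
    have h2 := hN n hn.le
    have hn0 : (0 : ℝ) < n := by exact_mod_cast (Nat.zero_le N).trans_lt hn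
    simp only [Pi.sub_apply, zero_add, h0, hB0, sub_self, smul_zero, sub_zero,
      Real.norm_eq_abs] at h2
    rw [Real.dist_eq, sub_zero, abs_of_nonneg (by positivity)]
    calc (n : ℝ) * ‖A (t / n) - B (t / n)‖ ≤ n * (ε / (|t| + 1) * |t / n|) := by gcongr
      _ = ε * (|t| / (|t| + 1)) := by
          rw [abs_div, abs_of_pos hn0]; field_simp
      _ < ε * 1 := by
          gcongr
          rw [div_lt_one (by positivity)]; linarith
      _ = ε := mul_one ε
  have hpow : ∀ᶠ n : ℕ in atTop, B (t / n) ^ n = NormedSpace.exp (t • K) := by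
    filter_upwards [eventually_gt_atTop 0] with n hn
    have hn0 : (n : ℝ) ≠ 0 := by exact_mod_cast hn.ne'
    rw [hBdef]
    simp only
    rw [← NormedSpace.exp_nsmul, ← Nat.cast_smul_eq_nsmul ℝ, smul_smul]
    congr 2
    field_simp
  have hsub : Tendsto (fun n : ℕ => A (t / n) ^ n - B (t / n) ^ n) atTop (𝓝 0) := by
    set c := (‖K‖ + 1) * |t|
    refine squeeze_zero_norm' (a := fun n : ℕ => (n : ℝ) * ‖A (t / n) - B (t / n)‖ * Real.exp c)
      ?_ (by simpa using hdiff.mul_const (Real.exp c))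
    filter_upwards [growth A h0 hA, growth B hB0 hB, eventually_gt_atTop 0] with n h1 h2 hn
    have hn0 : (0 : ℝ) < n := by exact_mod_cast hn
    have h3 := norm_pow_sub_pow_le_mul
      (le_add_of_nonneg_right (by positivity) : (1 : ℝ) ≤ 1 + (‖K‖ + 1) * |t / n|) h1 h2 n
    refine h3.trans (mul_le_mul_of_nonneg_left ?_ (by positivity))
    have h4 : 1 + (‖K‖ + 1) * |t / n| ≤ Real.exp (c / n) := by
      have : (‖K‖ + 1) * |t / n| = c / n := by
        rw [abs_div, abs_of_pos hn0]; simp only [c]; ring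
      rw [this, add_comm]
      exact Real.add_one_le_exp _
    calc (1 + (‖K‖ + 1) * |t / n|) ^ n ≤ Real.exp (c / n) ^ n :=
          pow_le_pow_left₀ (by positivity) h4 n
      _ = Real.exp c := by
          rw [← Real.exp_nat_mul]; congr 1; field_simp
  have := hsub.add (tendsto_const_nhds (x := NormedSpace.exp (t • K)))
  rw [zero_add] at this
  refine this.congr' ?_
  filter_upwards [hpow] with n hn
  rw [hn]; abel

end ProductFormula

/-! ### The killed semigroup as a limit of killed discrete steps. -/

section Killed

variable {V : Type*} [Fintype V] [DecidableEq V]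

open scoped Classical in
/-- The projection on the functions supported off `D`. -/
def offProj (D : Set V) : Matrix V V ℝ :=
  Matrix.diagonal fun x => if x ∈ D then 0 else 1

/-- The generator `L` killed on `D`. -/
def killed (D : Set V) (L : Matrix V V ℝ) : Matrix V V ℝ :=
  offProj D * L * offProj D

/-- One step of a chain with transition matrix `S`, killed on `D`. -/
def killedStep (D : Set V) (S : Matrix V V ℝ) : Matrix V V ℝ :=
  offProj D * S * offProj D + (1 - offProj D)

variable {D : Set V}

open scoped Classical in
theorem offProj_mul_mul_apply (S : Matrix V V ℝ) (x y : V) :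
    (offProj D * S * offProj D) x y = if x ∈ D ∨ y ∈ D then 0 else S x y := by
  rw [offProj, Matrix.mul_diagonal, Matrix.diagonal_mul]
  by_cases hx : x ∈ D <;> by_cases hy : y ∈ D <;> simp [hx, hy]

open scoped Classical in
-- Rows off `D` do not see the identity block on `D`, so they are genuine killed transition
-- probabilities when `S` is stochastic.
theorem killedStep_apply (S : Matrix V V ℝ) {x : V} (hx : x ∉ D) (y : V) :
    killedStep D S x y = if y ∈ D then 0 else S x y := by
  rw [killedStep, Matrix.add_apply, offProj_mul_mul_apply, Matrix.sub_apply, offProj]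
  by_cases hxy : x = y
  · subst hxy; simp [hx]
  · simp [hx, hxy]

theorem offProj_mul_self : offProj D * offProj D = offProj D := by
  classical
  rw [offProj, Matrix.diagonal_mul_diagonal]
  congr 1
  ext x
  split_ifs <;> simp

section Norms

open scoped Matrix.Norms.Operator

theorem hasDerivAt_killedStep (L : Matrix V V ℝ) :
    HasDerivAt (fun s : ℝ => killedStep D (NormedSpace.exp (s • L))) (killed D L) 0 := by
  have h := hasDerivAt_exp_smul_const L (0 : ℝ)
  rw [zero_smul, NormedSpace.exp_zero, one_mul] at h
  exact ((h.const_mul (offProj D)).mul_const (offProj D)).add_const _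

theorem tendsto_killedStep_pow (L : Matrix V V ℝ) (t : ℝ) :
    Tendsto (fun n : ℕ => killedStep D (NormedSpace.exp ((t / n) • L)) ^ n) atTop
      (𝓝 (NormedSpace.exp (t • killed D L))) := by
  -- The operator norm of the identity is `1` only on a nonempty index set.
  rcases isEmpty_or_nonempty V with hV | hV
  · exact tendsto_const_nhds.congr fun n => Subsingleton.elim _ _
  · refine tendsto_pow_exp_of_hasDerivAt (A := fun s => killedStep D (NormedSpace.exp (s • L)))
      ?_ (hasDerivAt_killedStep L) t
    -- The identity block on `D` makes the step equal to `1` at time `0`, as the product formula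
    -- requires.
    simp [killedStep, offProj_mul_self]

theorem hasDerivAt_exp_apply (K : Matrix V V ℝ) (t : ℝ) (x y : V) :
    HasDerivAt (fun s : ℝ => NormedSpace.exp (s • K) x y) ((NormedSpace.exp (t • K) * K) x y) t :=
  ((Matrix.entryLinearMap ℝ ℝ x y).toContinuousLinearMap.hasFDerivAt.comp_hasDerivAt t
    (hasDerivAt_exp_smul_const K t))

end Norms

theorem tendsto_killedStep_pow_apply (L : Matrix V V ℝ) (t : ℝ) (x y : V) :
    Tendsto (fun n : ℕ => (killedStep D (NormedSpace.exp ((t / n) • L)) ^ n) x y) atTop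
      (𝓝 (NormedSpace.exp (t • killed D L) x y)) :=
  ((tendsto_pi_nhds.1 ((tendsto_pi_nhds.1 (tendsto_killedStep_pow L t)) x)) y)

end Killed

/-! ### Hitting times of right-continuous paths. -/

section Paths

variable {V Ω : Type*} {X : ℝ≥0 → Ω → V} {D : Set V}

/-- Right-continuity makes the inequality strict: a path off `D` at time `t` stays off `D` on some
`[t, u)`. -/
theorem coe_lt_hittingTime_iff (hX : ∀ ω t, ∀ᶠ s in 𝓝[≥] t, X s ω = X t ω) (t : ℝ≥0) (ω : Ω) :
    (t : ℝ≥0∞) < hittingTime X D ω ↔ ∀ s ≤ t, X s ω ∉ D := by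
  classical
  rw [hittingTime, hittingAfter_def]
  simp only [zero_le, true_and]
  split_ifs with h
  · obtain ⟨j, hj⟩ := h
    rw [show (((sInf {i | X i ω ∈ D} : ℝ≥0) : WithTop ℝ≥0) : ℝ≥0∞) =
      ((sInf {i | X i ω ∈ D} : ℝ≥0) : ℝ≥0∞) from rfl, ENNReal.coe_lt_coe]
    constructor
    · intro hlt s hs hsD
      exact (hlt.trans_le (csInf_le (OrderBot.bddBelow _) hsD)).not_ge hs
    · intro hno
      obtain ⟨u, htu, hu⟩ := mem_nhdsGE_iff_exists_Ico_subset.1 (hX ω t)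
      refine lt_of_lt_of_le htu (le_csInf ⟨j, hj⟩ fun i hi => ?_)
      by_contra! hiu
      rcases le_or_gt i t with hit | hit
      · exact hno i hit hi
      · have : X i ω = X t ω := hu ⟨hit.le, hiu⟩
        exact hno t le_rfl (this ▸ hi)
  · push Not at h
    simp only [h, not_false_eq_true, implies_true, iff_true]
    exact ENNReal.coe_lt_top

/-- A right-continuous path avoids `D` up to time `t` as soon as it does at the dyadic times. -/
theorem forall_le_notMem_iff_dyadic (hX : ∀ ω t, ∀ᶠ s in 𝓝[≥] t, X s ω = X t ω) (t : ℝ≥0)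
    (ω : Ω) : (∀ s ≤ t, X s ω ∉ D) ↔
      ∀ j : ℕ, ∀ k : ℕ, k ≤ 2 ^ j → X ((k : ℝ≥0) * (t / 2 ^ j)) ω ∉ D := by
  have hpow : ∀ j : ℕ, (0 : ℝ≥0) < 2 ^ j := fun j => by positivity
  constructor
  · intro h j k hk
    refine h _ ?_
    calc (k : ℝ≥0) * (t / 2 ^ j) ≤ 2 ^ j * (t / 2 ^ j) := by gcongr; exact_mod_cast hk
      _ = t := mul_div_cancel₀ _ (hpow j).ne'
  · intro h s hs hsD
    have ht : X t ω ∉ D := by simpa using h 0 1 (by simp)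
    have hst : s < t := lt_of_le_of_ne hs fun e => ht (e ▸ hsD)
    have ht0 : 0 < t := (zero_le).trans_lt hst
    -- The visit to `D` lasts throughout `[s, u)`, which contains a grid point as soon as the mesh
    -- `t / 2 ^ j` is below `u - s`; rounding up keeps that point at most `t`.
    obtain ⟨u, hsu, hu⟩ := mem_nhdsGE_iff_exists_Ico_subset.1 (hX ω s)
    have hsu' : s < u := hsu
    obtain ⟨j, hj⟩ := pow_unbounded_of_one_lt ((t : ℝ) / (u - s)) one_lt_two
    have hus : (0 : ℝ) < u - s := sub_pos.2 (by exact_mod_cast hsu')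
    have ht0' : (0 : ℝ) < t := by exact_mod_cast ht0
    have hp : (0 : ℝ) < 2 ^ j := by positivity
    set k := ⌈(s : ℝ) * 2 ^ j / t⌉₊ with hk
    have hk1 : (s : ℝ) * 2 ^ j / t ≤ k := Nat.le_ceil _
    have hk2 : (k : ℝ) < s * 2 ^ j / t + 1 := Nat.ceil_lt_add_one (by positivity)
    have hk3 : k ≤ 2 ^ j := by
      rw [hk, Nat.ceil_le]
      push_cast
      rw [div_le_iff₀ ht0', mul_comm]
      gcongr
    have h1 : s ≤ (k : ℝ≥0) * (t / 2 ^ j) := by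
      rw [← NNReal.coe_le_coe]
      push_cast
      rw [div_le_iff₀ ht0'] at hk1
      rw [← mul_div_assoc, le_div_iff₀ hp]
      exact hk1
    have h2 : (k : ℝ≥0) * (t / 2 ^ j) < u := by
      rw [← NNReal.coe_lt_coe]
      push_cast
      rw [div_lt_iff₀ hus] at hj
      have h3 : (k : ℝ) * t < s * 2 ^ j + t := by
        calc (k : ℝ) * t < (s * 2 ^ j / t + 1) * t := by gcongr
          _ = _ := by field_simp
      rw [← mul_div_assoc, div_lt_iff₀ hp]
      nlinarith
    have h3 : X ((k : ℝ≥0) * (t / 2 ^ j)) ω = X s ω := hu ⟨h1, h2⟩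
    exact h j k hk3 (h3 ▸ hsD)

end Paths

/-! ### From finite-dimensional laws to the killed transition function. -/

namespace IsMetropolisChain

variable {V : Type*} [Fintype V] [DecidableEq V] {G : SimpleGraph V} [DecidableRel G.Adj]
  {H : V → ℝ} {β : ℝ} {a : V} {Ω : Type*} [MeasurableSpace Ω] {P : Measure Ω}
  {X : ℝ≥0 → Ω → V} {D : Set V}

theorem measurableSet_mem (hX : IsMetropolisChain G H β a P X) (t : ℝ≥0) (S : Set V) :
    MeasurableSet {ω | X t ω ∈ S} := by
  have : {ω | X t ω ∈ S} = ⋃ x ∈ S, {ω | X t ω = x} := by ext ω; simp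
  rw [this]
  exact S.toFinite.measurableSet_biUnion fun x _ => hX.measurableSet_eq t x

theorem measurableSet_dyadic (hX : IsMetropolisChain G H β a P X) (D : Set V) (δ : ℝ≥0) (n : ℕ) :
    MeasurableSet {ω | ∀ k ≤ n, X ((k : ℝ≥0) * δ) ω ∉ D} := by
  have : {ω | ∀ k ≤ n, X ((k : ℝ≥0) * δ) ω ∉ D} =
      ⋂ k : ℕ, ⋂ _ : k ≤ n, {ω | X ((k : ℝ≥0) * δ) ω ∈ Dᶜ} := by
    ext ω; simp
  rw [this]
  exact MeasurableSet.iInter fun k => MeasurableSet.iInter fun _ => hX.measurableSet_mem _ _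

theorem measurableSet_lt_hittingTime (hX : IsMetropolisChain G H β a P X) (D : Set V)
    (t : ℝ≥0) : MeasurableSet {ω | (t : ℝ≥0∞) < hittingTime X D ω} := by
  simp only [coe_lt_hittingTime_iff hX.rightContinuous,
    forall_le_notMem_iff_dyadic hX.rightContinuous]
  rw [Set.ofPred_forall]
  exact MeasurableSet.iInter fun j => hX.measurableSet_dyadic D _ _

theorem measurable_hittingTime (hX : IsMetropolisChain G H β a P X) (D : Set V) :
    Measurable (hittingTime X D) := by
  refine measurable_of_Ioi fun x => ?_
  induction x with
  | top => simp
  | coe t => exact hX.measurableSet_lt_hittingTime D t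

/-- The Markov property at the times `k * δ`: a given beginning of the path, followed by a path
off `D`. -/
theorem measureReal_path (hX : IsMetropolisChain G H β a P X) [IsProbabilityMeasure P]
    (δ : ℝ≥0) (y : V) (d : ℕ) : ∀ (m : ℕ) (x : ℕ → V), x m ∉ D →
    P.real {ω | (∀ k ≤ m, X ((k : ℝ≥0) * δ) ω = x k) ∧
        (∀ k, m < k → k ≤ m + d → X ((k : ℝ≥0) * δ) ω ∉ D) ∧
        X (((m + d : ℕ) : ℝ≥0) * δ) ω = y} =
      (if x 0 = a then 1 else 0) *
        (∏ k ∈ Finset.range m, semigroup G H β δ (x k) (x (k + 1))) *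
        (killedStep D (semigroup G H β δ) ^ d) (x m) y := by
  classical
  induction d with
  | zero =>
    intro m x hxm
    have hfd := hX.finDimDistr m (fun k => (k : ℝ≥0) * δ) x (by simp)
      (fun i j hij => by dsimp only; gcongr)
    have hstep : ∀ k : ℕ, ((((k + 1 : ℕ) : ℝ≥0) * δ : ℝ≥0) : ℝ) - (((k : ℝ≥0) * δ : ℝ≥0) : ℝ) =
        (δ : ℝ) := fun k => by push_cast; ring
    simp only [hstep] at hfd
    rw [pow_zero, Matrix.one_apply, ← hfd]
    by_cases hy : x m = y
    · rw [if_pos hy, mul_one]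
      congr 1
      ext ω
      simp only [Set.mem_ofPred_eq, add_zero]
      exact ⟨fun h => h.1, fun h => ⟨h, fun k h1 h2 => absurd h2 h1.not_ge,
        (h m le_rfl).trans hy⟩⟩
    · rw [if_neg hy, mul_zero]
      refine (measureReal_congr (t := ∅) ?_).trans measureReal_empty
      refine Eventually.of_forall fun ω => ?_
      refine propext ⟨fun h => ?_, fun h => h.elim⟩
      exact hy ((h.1 m le_rfl).symm.trans (by simpa using h.2.2))
  | succ d ih =>
    intro m x hxm
    -- The event is split by the state `z ∉ D` at the first free time `m + 1`, which joins the
    -- prescribed beginning; hence the induction on `d` is over all `m` and `x`.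
    set E : V → Set Ω := fun z => {ω | (∀ k ≤ m + 1, X ((k : ℝ≥0) * δ) ω =
          Function.update x (m + 1) z k) ∧
        (∀ k, m + 1 < k → k ≤ m + 1 + d → X ((k : ℝ≥0) * δ) ω ∉ D) ∧
        X (((m + 1 + d : ℕ) : ℝ≥0) * δ) ω = y} with hE
    set F : Finset V := Finset.univ.filter (· ∉ D) with hF
    have hupd : ∀ z, ∀ k ≤ m, Function.update x (m + 1) z k = x k := fun z k hk =>
      Function.update_of_ne (by omega) _ _
    have hset : {ω | (∀ k ≤ m, X ((k : ℝ≥0) * δ) ω = x k) ∧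
        (∀ k, m < k → k ≤ m + (d + 1) → X ((k : ℝ≥0) * δ) ω ∉ D) ∧
        X (((m + (d + 1) : ℕ) : ℝ≥0) * δ) ω = y} = ⋃ z ∈ F, E z := by
      ext ω
      simp only [Set.mem_ofPred_eq, Set.mem_iUnion, hE, hF, Finset.mem_filter, Finset.mem_univ,
        true_and, exists_prop]
      rw [show m + (d + 1) = m + 1 + d by omega]
      constructor
      · rintro ⟨h1, h2, h3⟩
        refine ⟨_, h2 (m + 1) (by omega) (by omega), fun k hk => ?_,
          fun k hk hk' => h2 k (by omega) hk', h3⟩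
        rcases Nat.lt_or_ge k (m + 1) with hlt | hge
        · rw [hupd _ k (by omega)]; exact h1 k (by omega)
        · obtain rfl : k = m + 1 := by omega
          rw [Function.update_self]
      · rintro ⟨z, hz, h1, h2, h3⟩
        refine ⟨fun k hk => ?_, fun k hk hk' => ?_, h3⟩
        · rw [h1 k (by omega), hupd _ k hk]
        · rcases Nat.lt_or_ge (m + 1) k with hlt | hge
          · exact h2 k hlt hk'
          · obtain rfl : k = m + 1 := by omega
            rw [h1 _ le_rfl, Function.update_self]; exact hz
    have hmeas : ∀ z ∈ F, MeasurableSet (E z) := by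
      intro z _
      have : E z = (⋂ k : ℕ, ⋂ _ : k ≤ m + 1,
          {ω | X ((k : ℝ≥0) * δ) ω = Function.update x (m + 1) z k}) ∩
          ((⋂ k : ℕ, ⋂ _ : m + 1 < k, ⋂ _ : k ≤ m + 1 + d, {ω | X ((k : ℝ≥0) * δ) ω ∈ Dᶜ}) ∩
          {ω | X (((m + 1 + d : ℕ) : ℝ≥0) * δ) ω = y}) := by
        ext ω; simp [hE]
      rw [this]
      exact (MeasurableSet.iInter fun k => MeasurableSet.iInter fun _ =>
        hX.measurableSet_eq _ _).inter ((MeasurableSet.iInter fun k => MeasurableSet.iInter fun _ =>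
        MeasurableSet.iInter fun _ => hX.measurableSet_mem _ _).inter (hX.measurableSet_eq _ _))
    have hdisj : (F : Set V).PairwiseDisjoint E := by
      intro z _ w _ hzw
      refine Set.disjoint_left.2 fun ω h1 h2 => hzw ?_
      have e1 := h1.1 (m + 1) le_rfl
      have e2 := h2.1 (m + 1) le_rfl
      rw [Function.update_self] at e1 e2
      exact e1.symm.trans e2
    rw [hset, measureReal_biUnion_finset hdisj hmeas, pow_succ', Matrix.mul_apply, Finset.mul_sum,
      Finset.sum_filter]
    refine Finset.sum_congr rfl fun z _ => ?_
    rw [killedStep_apply _ hxm]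
    by_cases hz : z ∈ D
    · simp [hz]
    · rw [if_pos hz, if_neg hz, hE, ih (m + 1) (Function.update x (m + 1) z)
        (by rwa [Function.update_self]), Finset.prod_range_succ, Function.update_self,
        hupd z 0 (Nat.zero_le _), hupd z m le_rfl]
      have : ∏ k ∈ Finset.range m, semigroup G H β δ (Function.update x (m + 1) z k)
          (Function.update x (m + 1) z (k + 1)) =
          ∏ k ∈ Finset.range m, semigroup G H β δ (x k) (x (k + 1)) :=
        Finset.prod_congr rfl fun k hk => by
          have := Finset.mem_range.1 hk
          rw [hupd z k (by omega), hupd z (k + 1) (by omega)]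
      rw [this]
      ring

theorem ae_zero_eq (hX : IsMetropolisChain G H β a P X) [IsProbabilityMeasure P] :
    ∀ᵐ ω ∂P, X 0 ω = a := by
  have h := hX.finDimDistr 0 (fun _ => 0) (fun _ => a) rfl monotone_const
  simp only [Nat.le_zero, forall_eq, if_true, Finset.range_zero, Finset.prod_empty,
    mul_one] at h
  have h2 : P {ω | X 0 ω = a} = 1 := by
    rwa [measureReal_def, ENNReal.toReal_eq_one_iff] at h
  exact (prob_compl_eq_zero_iff (hX.measurableSet_eq 0 a)).2 h2

/-- The transition function of the dynamics killed on `D`. -/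
theorem measureReal_lt_hittingTime_inter (hX : IsMetropolisChain G H β a P X)
    [IsProbabilityMeasure P] (ha : a ∉ D) (t : ℝ≥0) (y : V) :
    P.real ({ω | (t : ℝ≥0∞) < hittingTime X D ω} ∩ {ω | X t ω = y}) =
      NormedSpace.exp ((t : ℝ) • killed D (generator G H β)) a y := by
  set F : ℕ → Set Ω := fun j => {ω | ∀ k : ℕ, k ≤ 2 ^ j → X ((k : ℝ≥0) * (t / 2 ^ j)) ω ∉ D} with hF
  have hset : {ω | (t : ℝ≥0∞) < hittingTime X D ω} ∩ {ω | X t ω = y} =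
      ⋂ j, F j ∩ {ω | X t ω = y} := by
    rw [← Set.iInter_inter]
    congr 1
    ext ω
    simp only [Set.mem_ofPred_eq, coe_lt_hittingTime_iff hX.rightContinuous,
      forall_le_notMem_iff_dyadic hX.rightContinuous t, hF, Set.mem_iInter]
  have hmeas : ∀ j, MeasurableSet (F j ∩ {ω | X t ω = y}) := fun j =>
    (hX.measurableSet_dyadic D _ _).inter (hX.measurableSet_eq t y)
  have hanti : Antitone fun j => F j ∩ {ω | X t ω = y} := by
    refine antitone_nat_of_succ_le fun j => Set.inter_subset_inter_left _ fun ω h k hk => ?_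
    have := h (2 * k) (by rw [pow_succ']; omega)
    have e : ((2 * k : ℕ) : ℝ≥0) * (t / 2 ^ (j + 1)) = (k : ℝ≥0) * (t / 2 ^ j) := by
      rw [pow_succ]; push_cast; field_simp
    rwa [e] at this
  have h1 : Tendsto (fun j => P.real (F j ∩ {ω | X t ω = y})) atTop
      (𝓝 (P.real (⋂ j, F j ∩ {ω | X t ω = y}))) :=
    (ENNReal.tendsto_toReal (measure_ne_top _ _)).comp
      (tendsto_measure_iInter_atTop (fun j => (hmeas j).nullMeasurableSet) hanti
        ⟨0, measure_ne_top _ _⟩)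
  have h2 : ∀ j : ℕ, P.real (F j ∩ {ω | X t ω = y}) =
      (killedStep D (NormedSpace.exp (((t : ℝ) / ((2 ^ j : ℕ) : ℝ)) • generator G H β)) ^ (2 ^ j))
        a y := by
    intro j
    -- Only time `0` is prescribed; the other `2 ^ j` grid times are killed steps.
    have h := hX.measureReal_path (D := D) (t / 2 ^ j) y (2 ^ j) 0 (fun _ => a) ha
    simp only [if_true, Finset.range_zero, Finset.prod_empty, one_mul, zero_add] at h
    have e : (((2 ^ j : ℕ) : ℝ≥0)) * (t / 2 ^ j) = t := by
      push_cast
      exact mul_div_cancel₀ _ (by positivity)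
    rw [e] at h
    rw [show ((t : ℝ) / ((2 ^ j : ℕ) : ℝ)) = ((t / 2 ^ j : ℝ≥0) : ℝ) by push_cast; rfl]
    rw [← semigroup, ← h]
    refine measureReal_congr ?_
    filter_upwards [hX.ae_zero_eq] with ω hω
    refine propext ⟨fun h => ⟨fun k hk => ?_, fun k _ hk => h.1 k hk, h.2⟩,
      fun h => ⟨fun k hk => ?_, h.2.2⟩⟩
    · obtain rfl := Nat.le_zero.1 hk
      simpa using hω
    · rcases Nat.eq_zero_or_pos k with rfl | hk0
      · simpa [hω] using ha
      · exact h.2.1 k hk0 hk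
  rw [hset]
  -- Continuity from above and the product formula along `n = 2 ^ j` compute the same limit.
  refine tendsto_nhds_unique h1 ?_
  simp only [h2]
  exact (tendsto_killedStep_pow_apply (generator G H β) t a y).comp
    (tendsto_pow_atTop_atTop_of_one_lt one_lt_two)

end IsMetropolisChain

/-! ### Characteristic functions from tails. -/

section CharFun

theorem hasDerivAt_exp_I_mul (l t : ℝ) : HasDerivAt (fun s : ℝ => Complex.exp (Complex.I * l * s))
    (Complex.I * l * Complex.exp (Complex.I * l * t)) t := by
  have h := ((Complex.ofRealCLM.hasDerivAt (x := t)).const_mul (Complex.I * l)).cexp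
  simpa [mul_comm] using h

theorem norm_exp_I_mul (l t : ℝ) : ‖Complex.exp (Complex.I * l * t)‖ = 1 := by
  rw [mul_assoc, ← Complex.ofReal_mul, mul_comm]
  exact Complex.norm_exp_ofReal_mul_I _

/-- The characteristic function of a nonnegative random variable from its tail. -/
theorem integral_exp_eq_of_tail {Ω : Type*} [MeasurableSpace Ω] {P : Measure Ω}
    [IsProbabilityMeasure P] {Y : Ω → ℝ} (hY : Measurable Y) (hY0 : ∀ᵐ ω ∂P, 0 ≤ Y ω)
    {s : ℝ → ℝ} (hs : ∀ t > 0, P.real {ω | t < Y ω} = s t)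
    (hint : IntegrableOn s (Set.Ioi 0)) (l : ℝ) :
    ∫ ω, Complex.exp (Complex.I * l * Y ω) ∂P =
      1 + ∫ t in Set.Ioi (0 : ℝ), Complex.I * l * Complex.exp (Complex.I * l * t) * s t := by
  set e : ℝ → ℂ := fun t => Complex.I * l * Complex.exp (Complex.I * l * t) with he
  have hecont : Continuous e := by fun_prop
  have henorm : ∀ t, ‖e t‖ = |l| := fun t => by
    rw [he]; simp only
    rw [norm_mul, norm_exp_I_mul, norm_mul, Complex.norm_I, Complex.norm_real]; simp
  set A : Set (Ω × ℝ) := {p | p.2 < Y p.1} with hA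
  have hAm : MeasurableSet A := measurableSet_lt measurable_snd (hY.comp measurable_fst)
  -- Fubini is applied to `exp (i l Y) - 1`, the integral of `e` over `(0, Y)`; integrability of the
  -- tail justifies the exchange.
  set h : Ω × ℝ → ℂ := A.indicator fun p => e p.2 with hh
  have hm : Measurable h := (hecont.measurable.comp measurable_snd).indicator hAm
  have hset : ∀ t, MeasurableSet {ω | t < Y ω} := fun t => measurableSet_lt measurable_const hY
  have hsec : ∀ t, (fun ω => h (ω, t)) = {ω | t < Y ω}.indicator fun _ => e t := fun t => by
    ext ω; simp [hh, hA, Set.indicator]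
  have hprod : Integrable h (P.prod (volume.restrict (Set.Ioi 0))) := by
    rw [integrable_prod_iff' hm.aestronglyMeasurable]
    refine ⟨Eventually.of_forall fun t => ?_, ?_⟩
    · rw [hsec]
      exact (integrable_const _).indicator (hset t)
    · refine (hint.const_mul |l|).congr ?_
      filter_upwards [ae_restrict_mem measurableSet_Ioi] with t ht
      have : (fun ω => ‖h (ω, t)‖) = {ω | t < Y ω}.indicator fun _ => |l| := by
        ext ω
        rw [congrFun (hsec t) ω, norm_indicator_eq_indicator_norm, henorm]
      rw [this, integral_indicator_const _ (hset t), hs t ht, smul_eq_mul, mul_comm]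
  have hswap := integral_integral_swap (f := fun ω t => h (ω, t)) hprod
  have hleft : ∀ᵐ ω ∂P, ∫ t in Set.Ioi (0 : ℝ), h (ω, t) =
      Complex.exp (Complex.I * l * Y ω) - 1 := by
    filter_upwards [hY0] with ω hω
    have e1 : (fun t => h (ω, t)) = (Set.Iio (Y ω)).indicator e := by
      ext t; simp [hh, hA, Set.indicator]
    rw [e1, setIntegral_indicator measurableSet_Iio, Set.Ioi_inter_Iio, ← integral_Ioc_eq_integral_Ioo,
      ← intervalIntegral.integral_of_le hω,
      intervalIntegral.integral_eq_sub_of_hasDerivAt (fun t _ => hasDerivAt_exp_I_mul l t)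
        (hecont.intervalIntegrable _ _)]
    simp
  have hright : ∫ t in Set.Ioi (0 : ℝ), ∫ ω, h (ω, t) ∂P =
      ∫ t in Set.Ioi (0 : ℝ), e t * s t := by
    refine setIntegral_congr_fun measurableSet_Ioi fun t ht => ?_
    rw [hsec, integral_indicator_const _ (hset t), hs t ht, Complex.real_smul, mul_comm]
  rw [integral_congr_ae hleft, hright, integral_sub, integral_const, probReal_univ, one_smul]
    at hswap
  · linear_combination hswap
  · refine Integrable.mono' (integrable_const 1) ?_
      (Eventually.of_forall fun ω => (norm_exp_I_mul l (Y ω)).le)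
    exact Measurable.aestronglyMeasurable (by fun_prop)
  · exact integrable_const _

/-- The characteristic function of the exponential law of mean `1`. -/
theorem charFun_expMeasure_one (u : ℝ) :
    charFun (expMeasure 1) u = (1 - Complex.I * u)⁻¹ := by
  have htail : ∀ t ≥ 0, (expMeasure 1).real {x | t < x} = Real.exp (-t) := fun t ht => by
    have h := cdf_expMeasure_eq one_pos t
    rw [cdf_eq_real, if_pos ht, one_mul] at h
    have h2 := probReal_compl_eq_one_sub (μ := expMeasure 1) (measurableSet_Iic (a := t))
    rw [Set.compl_Iic, h, sub_sub_cancel] at h2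
    exact h2
  have hpos : ∀ᵐ x ∂(expMeasure 1), (0 : ℝ) ≤ x := by
    have h := htail 0 le_rfl
    rw [neg_zero, Real.exp_zero, measureReal_def, ENNReal.toReal_eq_one_iff] at h
    have h2 := (prob_compl_eq_zero_iff (μ := expMeasure 1) measurableSet_Ioi).2 h
    filter_upwards [show ∀ᵐ x ∂(expMeasure 1), x ∈ Set.Ioi (0 : ℝ) from h2] with x hx
    exact le_of_lt hx
  have hint : IntegrableOn (fun t : ℝ => Real.exp (-t)) (Set.Ioi 0) := by
    simpa using exp_neg_integrableOn_Ioi 0 one_pos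
  have h := integral_exp_eq_of_tail measurable_id hpos (fun t ht => htail t (le_of_lt ht)) hint u
  have hre : (Complex.I * u - 1 : ℂ).re < 0 := by simp
  have hne : (1 - Complex.I * u : ℂ) ≠ 0 := fun h => by
    have := congrArg Complex.re h
    simp at this
  have hI : ∫ t in Set.Ioi (0 : ℝ), Complex.I * u * Complex.exp (Complex.I * u * t) *
      (Real.exp (-t) : ℝ) = Complex.I * u * (1 - Complex.I * u)⁻¹ := by
    have e : ∀ t : ℝ, Complex.I * u * Complex.exp (Complex.I * u * t) * (Real.exp (-t) : ℝ) =
        Complex.I * u * Complex.exp ((Complex.I * u - 1) * t) := fun t => by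
      push_cast
      rw [mul_assoc, ← Complex.exp_add]
      congr 2; ring
    simp only [e]
    rw [integral_const_mul, integral_exp_mul_complex_Ioi hre]
    congr 1
    rw [show (Complex.I * u - 1 : ℂ) = -(1 - Complex.I * u) by ring, Complex.ofReal_zero,
      mul_zero, Complex.exp_zero, neg_div_neg_eq, one_div]
  rw [hI] at h
  rw [charFun_apply_real]
  calc ∫ x, Complex.exp (u * x * Complex.I) ∂(expMeasure 1)
      = ∫ x, Complex.exp (Complex.I * u * (id x : ℝ)) ∂(expMeasure 1) :=
        integral_congr_ae (Eventually.of_forall fun x => by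
          simp only [id]; congr 1; ring)
    _ = _ := by rw [h]; field_simp; ring

end CharFun

/-! ### Mean and characteristic function of the hitting time as Dirichlet solutions. -/

theorem mean_nonneg {V : Type*} [Fintype V] {G : SimpleGraph V} [DecidableRel G.Adj]
    {H : V → ℝ} {β : ℝ} {D : Set V} {T : V → ℝ} (hG : G.Connected) (hD : D.Nonempty) (hT0 : ∀ x ∈ D, T x = 0)
    (hT : ∀ x ∉ D, ∑ y, rate G H β x y * (T y - T x) = -1) (x : V) : 0 ≤ T x := by
  refine neg_nonpos.1 (maximum_principle (q := rate G H β) rate_nonneg (isIrreducible_rate hG) hD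
    (f := fun x => -T x) (fun x hx => by simp [hT0 x hx]) (fun x hx => ?_) x)
  have e : ∀ y, rate G H β x y * (-T y - -T x) = -(rate G H β x y * (T y - T x)) :=
    fun y => by ring
  simp only [e, Finset.sum_neg_distrib, hT x hx, neg_neg, zero_le_one]

namespace IsMetropolisChain

variable {V : Type*} [Fintype V] [DecidableEq V] {G : SimpleGraph V} [DecidableRel G.Adj]
  {H : V → ℝ} {β : ℝ} {a : V} {Ω : Type*} [MeasurableSpace Ω] {P : Measure Ω}
  [IsProbabilityMeasure P] {X : ℝ≥0 → Ω → V} {D : Set V}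

variable (G H β a D) in
/-- The transition function, from `a`, of the dynamics killed on `D`. -/
def killedRow (t : ℝ) (y : V) : ℝ :=
  NormedSpace.exp (t • killed D (generator G H β)) a y

variable (G H β a D) in
/-- The probability that the dynamics started from `a` has not reached `D` at time `t`. -/
def survival (t : ℝ) : ℝ :=
  ∑ y, killedRow G H β a D t y

theorem killedRow_nonneg (hX : IsMetropolisChain G H β a P X) (ha : a ∉ D) {t : ℝ} (ht : 0 ≤ t)
    (y : V) : 0 ≤ killedRow G H β a D t y := by
  rw [killedRow, ← Real.coe_toNNReal t ht, ← hX.measureReal_lt_hittingTime_inter ha]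
  exact measureReal_nonneg

theorem killedRow_eq_zero (hX : IsMetropolisChain G H β a P X) (ha : a ∉ D) {t : ℝ} (ht : 0 ≤ t)
    {y : V} (hy : y ∈ D) : killedRow G H β a D t y = 0 := by
  rw [killedRow, ← Real.coe_toNNReal t ht, ← hX.measureReal_lt_hittingTime_inter ha]
  refine (measureReal_congr (t := ∅) ?_).trans measureReal_empty
  refine Eventually.of_forall fun ω => propext ⟨fun h => ?_, fun h => h.elim⟩
  exact (coe_lt_hittingTime_iff hX.rightContinuous _ ω).1 h.1 _ le_rfl (by
    have : X t.toNNReal ω = y := h.2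
    rwa [this])

theorem measureReal_lt_hittingTime (hX : IsMetropolisChain G H β a P X) (ha : a ∉ D) {t : ℝ}
    (ht : 0 ≤ t) : P.real {ω | ENNReal.ofReal t < hittingTime X D ω} =
      survival G H β a D t := by
  have h1 : ∀ y, killedRow G H β a D t y =
      P.real ({ω | ENNReal.ofReal t < hittingTime X D ω} ∩ {ω | X t.toNNReal ω = y}) := by
    intro y
    have := hX.measureReal_lt_hittingTime_inter ha t.toNNReal y
    rw [Real.coe_toNNReal t ht] at this
    exact this.symm
  simp only [survival, h1]
  rw [← measureReal_biUnion_finset]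
  · congr 1
    ext ω; simp
  · intro y _ z _ hyz
    exact Set.disjoint_left.2 fun ω h2 h3 => hyz ((h2.2 : _ = y).symm.trans h3.2)
  · exact fun y _ => (hX.measurableSet_lt_hittingTime D _).inter (hX.measurableSet_eq _ y)

theorem survival_nonneg (hX : IsMetropolisChain G H β a P X) (ha : a ∉ D) {t : ℝ} (ht : 0 ≤ t) :
    0 ≤ survival G H β a D t :=
  Finset.sum_nonneg fun y _ => hX.killedRow_nonneg ha ht y

theorem survival_anti (hX : IsMetropolisChain G H β a P X) (ha : a ∉ D) {s t : ℝ} (hs : 0 ≤ s)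
    (hst : s ≤ t) : survival G H β a D t ≤ survival G H β a D s := by
  rw [← hX.measureReal_lt_hittingTime ha hs, ← hX.measureReal_lt_hittingTime ha (hs.trans hst)]
  exact measureReal_mono fun ω h => (ENNReal.ofReal_le_ofReal hst).trans_lt h

/-- For `f` vanishing on `D` the right-hand projection is invisible, so killing only erases the rows
in `D`. -/
theorem killed_generator_sum {f : V → ℂ} (hf : ∀ x ∈ D, f x = 0) (x : V) :
    ∑ y, (killed D (generator G H β) x y : ℂ) * f y =
      (offProj D x x : ℂ) * ∑ y, (rate G H β x y : ℂ) * (f y - f x) := by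
  classical
  have h1 : ∀ y, (killed D (generator G H β) x y : ℂ) * f y =
      (offProj D x x : ℂ) * (generator G H β x y * f y) := fun y => by
    rw [killed, offProj_mul_mul_apply, offProj, Matrix.diagonal_apply_eq]
    by_cases hx : x ∈ D <;> by_cases hy : y ∈ D <;> simp [hx, hy, hf]
  simp only [h1, ← Finset.mul_sum]
  congr 1
  have h2 : ∀ y, (generator G H β x y : ℂ) * f y = rate G H β x y * f y -
      if x = y then (∑ z, (rate G H β x z : ℂ)) * f x else 0 := fun y => by
    rw [generator, Matrix.sub_apply, Matrix.of_apply, Matrix.diagonal_apply]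
    split_ifs with h
    · subst h; push_cast; ring
    · simp
  simp only [h2, mul_sub, Finset.sum_sub_distrib, Finset.sum_ite_eq, Finset.mem_univ, if_true,
    Finset.sum_mul]

/-- Kolmogorov's equation for a solution of `L f + i l f = -c` off `D`, `f = 0` on `D`. -/
theorem hasDerivAt_exp_mul_sum (hX : IsMetropolisChain G H β a P X) (ha : a ∉ D) {f : V → ℂ}
    {l : ℝ} {c : ℂ} (hf0 : ∀ x ∈ D, f x = 0)
    (hf : ∀ x ∉ D, ∑ y, (rate G H β x y : ℂ) * (f y - f x) + Complex.I * l * f x = -c)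
    {t : ℝ} (ht : 0 ≤ t) :
    HasDerivAt (fun s : ℝ => Complex.exp (Complex.I * l * s) *
      ∑ y, (killedRow G H β a D s y : ℂ) * f y)
      (-(c * Complex.exp (Complex.I * l * t) * survival G H β a D t)) t := by
  classical
  have h1 : HasDerivAt (fun s : ℝ => ∑ y, (killedRow G H β a D s y : ℂ) * f y)
      (∑ y, (((NormedSpace.exp (t • killed D (generator G H β)) *
        killed D (generator G H β)) a y : ℝ) : ℂ) * f y) t :=
    HasDerivAt.fun_sum fun y _ =>
      ((hasDerivAt_exp_apply (killed D (generator G H β)) t a y).ofReal_comp).mul_const (f y)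
  -- The killed generator is moved onto `f`, where the equation applies off `D`; the row has no mass
  -- on `D`. The term in `i l` is cancelled by the derivative of the exponential prefactor.
  have h2 : ∑ y, (((NormedSpace.exp (t • killed D (generator G H β)) *
        killed D (generator G H β)) a y : ℝ) : ℂ) * f y =
      -(c * survival G H β a D t) - Complex.I * l * ∑ y, (killedRow G H β a D t y : ℂ) * f y := by
    calc ∑ y, (((NormedSpace.exp (t • killed D (generator G H β)) *
          killed D (generator G H β)) a y : ℝ) : ℂ) * f y
        = ∑ z, (killedRow G H β a D t z : ℂ) *
            ∑ y, (killed D (generator G H β) z y : ℂ) * f y := by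
          simp only [Matrix.mul_apply, Complex.ofReal_sum, Complex.ofReal_mul, Finset.sum_mul,
            Finset.mul_sum]
          rw [Finset.sum_comm]
          exact Finset.sum_congr rfl fun z _ => Finset.sum_congr rfl fun y _ => by
            rw [killedRow]; ring
      _ = ∑ z, ((killedRow G H β a D t z : ℂ) * (-c) -
            Complex.I * l * ((killedRow G H β a D t z : ℂ) * f z)) := by
          refine Finset.sum_congr rfl fun z _ => ?_
          rw [killed_generator_sum hf0]
          by_cases hz : z ∈ D
          · simp [hX.killedRow_eq_zero ha ht hz]
          · rw [offProj, Matrix.diagonal_apply_eq, if_neg hz]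
            push_cast
            linear_combination (killedRow G H β a D t z : ℂ) * hf z hz
      _ = _ := by
          rw [Finset.sum_sub_distrib, ← Finset.sum_mul, ← Finset.mul_sum, survival]
          push_cast
          ring
  refine ((hasDerivAt_exp_I_mul l t).mul h1).congr_deriv ?_
  rw [h2]; ring

theorem killedRow_zero (y : V) : killedRow G H β a D 0 y = if a = y then 1 else 0 := by
  rw [killedRow, zero_smul, NormedSpace.exp_zero, Matrix.one_apply]

theorem norm_sum_killedRow_le (hX : IsMetropolisChain G H β a P X) (ha : a ∉ D) (f : V → ℂ)
    {t : ℝ} (ht : 0 ≤ t) : ‖∑ y, (killedRow G H β a D t y : ℂ) * f y‖ ≤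
      survival G H β a D t * ∑ y, ‖f y‖ := by
  refine (norm_sum_le _ _).trans ?_
  rw [survival, Finset.sum_mul]
  refine Finset.sum_le_sum fun y _ => ?_
  rw [norm_mul, Complex.norm_real, Real.norm_of_nonneg (hX.killedRow_nonneg ha ht y)]
  exact mul_le_mul_of_nonneg_left
    (Finset.single_le_sum (f := fun y => ‖f y‖) (fun _ _ => norm_nonneg _) (Finset.mem_univ y))
    (hX.killedRow_nonneg ha ht y)

variable {T : V → ℝ}

/-- Kolmogorov's equation for the mean hitting time. -/
theorem hasDerivAt_sum_mean (hX : IsMetropolisChain G H β a P X) (ha : a ∉ D)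
    (hT0 : ∀ x ∈ D, T x = 0) (hT : ∀ x ∉ D, ∑ y, rate G H β x y * (T y - T x) = -1)
    {t : ℝ} (ht : 0 ≤ t) :
    HasDerivAt (fun s : ℝ => ∑ y, killedRow G H β a D s y * T y)
      (-survival G H β a D t) t := by
  have h := hX.hasDerivAt_exp_mul_sum ha (f := fun x => (T x : ℂ)) (l := 0) (c := 1)
    (fun x hx => by simp [hT0 x hx])
    (fun x hx => by
      rw [Complex.ofReal_zero, mul_zero, zero_mul, add_zero]
      exact_mod_cast hT x hx) ht
  have h2 := Complex.reCLM.hasFDerivAt.comp_hasDerivAt t h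
  simpa [Function.comp_def] using h2

/-- A Markov inequality available before `T a` is known to be the mean: survival is nonincreasing
and is minus the derivative of a nonnegative function starting at `T a`. -/
theorem mul_survival_le (hX : IsMetropolisChain G H β a P X) (hG : G.Connected) (hD : D.Nonempty)
    (ha : a ∉ D) (hT0 : ∀ x ∈ D, T x = 0)
    (hT : ∀ x ∉ D, ∑ y, rate G H β x y * (T y - T x) = -1) {N : ℝ} (hN : 0 ≤ N) :
    N * survival G H β a D N ≤ T a := by
  set F : ℝ → ℝ := fun s => ∑ y, killedRow G H β a D s y * T y with hF
  have hder : ∀ t, 0 ≤ t → HasDerivAt (fun s => F s + s * survival G H β a D N)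
      (-survival G H β a D t + survival G H β a D N) t := fun t ht => by
    have h := (hX.hasDerivAt_sum_mean ha hT0 hT ht).add
      ((hasDerivAt_id t).mul_const (survival G H β a D N))
    rw [one_mul] at h
    exact h
  have hanti : AntitoneOn (fun s => F s + s * survival G H β a D N) (Set.Icc 0 N) := by
    refine antitoneOn_of_deriv_nonpos (convex_Icc 0 N)
      (fun t ht => (hder t ht.1).continuousAt.continuousWithinAt)
      (fun t ht => (hder t (interior_subset ht).1).differentiableAt.differentiableWithinAt)
      (fun t ht => ?_)
    have ht' := interior_subset ht
    rw [(hder t ht'.1).deriv]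
    linarith [hX.survival_anti ha ht'.1 ht'.2]
  have h := hanti (Set.left_mem_Icc.2 hN) (Set.right_mem_Icc.2 hN) hN
  have hF0 : F 0 = T a := by simp [hF, killedRow_zero]
  have hFN : 0 ≤ F N := Finset.sum_nonneg fun y _ =>
    mul_nonneg (hX.killedRow_nonneg ha hN y) (mean_nonneg hG hD hT0 hT y)
  simp only [zero_mul, add_zero, hF0] at h
  linarith

theorem tendsto_survival (hX : IsMetropolisChain G H β a P X) (hG : G.Connected)
    (hD : D.Nonempty) (ha : a ∉ D) (hT0 : ∀ x ∈ D, T x = 0)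
    (hT : ∀ x ∉ D, ∑ y, rate G H β x y * (T y - T x) = -1) :
    Tendsto (survival G H β a D) atTop (𝓝 0) := by
  refine squeeze_zero' (g := fun N => T a / N) ?_ ?_ (tendsto_const_nhds.div_atTop tendsto_id)
  · filter_upwards [eventually_ge_atTop 0] with t ht using hX.survival_nonneg ha ht
  · filter_upwards [eventually_gt_atTop 0] with t ht
    rw [le_div_iff₀ ht, mul_comm]
    exact hX.mul_survival_le hG hD ha hT0 hT ht.le

theorem tendsto_sum_killedRow (hX : IsMetropolisChain G H β a P X) (hG : G.Connected)
    (hD : D.Nonempty) (ha : a ∉ D) (hT0 : ∀ x ∈ D, T x = 0)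
    (hT : ∀ x ∉ D, ∑ y, rate G H β x y * (T y - T x) = -1) (f : V → ℂ) :
    Tendsto (fun t => ∑ y, (killedRow G H β a D t y : ℂ) * f y) atTop (𝓝 0) := by
  refine squeeze_zero_norm' (a := fun t => survival G H β a D t * ∑ y, ‖f y‖) ?_
    (by simpa using (hX.tendsto_survival hG hD ha hT0 hT).mul_const (∑ y, ‖f y‖))
  filter_upwards [eventually_ge_atTop 0] with t ht using hX.norm_sum_killedRow_le ha f ht

/-- Survival is minus the derivative of a function going from `T a` to `0`; its sign gives
integrability. -/
theorem integrableOn_survival (hX : IsMetropolisChain G H β a P X) (hG : G.Connected)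
    (hD : D.Nonempty) (ha : a ∉ D) (hT0 : ∀ x ∈ D, T x = 0)
    (hT : ∀ x ∉ D, ∑ y, rate G H β x y * (T y - T x) = -1) :
    IntegrableOn (survival G H β a D) (Set.Ioi 0) ∧
      ∫ t in Set.Ioi (0 : ℝ), survival G H β a D t = T a := by
  have hder := fun t (ht : (0 : ℝ) ≤ t) => hX.hasDerivAt_sum_mean ha hT0 hT ht
  have hlim : Tendsto (fun t => ∑ y, killedRow G H β a D t y * T y) atTop (𝓝 0) := by
    have h := (Complex.continuous_re.tendsto 0).comp
      (hX.tendsto_sum_killedRow hG hD ha hT0 hT (fun x => (T x : ℂ)))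
    simpa [Function.comp_def] using h
  have hint : IntegrableOn (fun t => -survival G H β a D t) (Set.Ioi 0) :=
    integrableOn_Ioi_deriv_of_nonpos (hder 0 le_rfl).continuousAt.continuousWithinAt
      (fun t ht => hder t (le_of_lt ht))
      (fun t ht => neg_nonpos.2 (hX.survival_nonneg ha (le_of_lt ht))) hlim
  have hval := integral_Ioi_of_hasDerivAt_of_tendsto
    (hder 0 le_rfl).continuousAt.continuousWithinAt (fun t ht => hder t (le_of_lt ht)) hint hlim
  refine ⟨by simpa using hint.neg, ?_⟩
  rw [integral_neg] at hval
  simpa [killedRow_zero] using hval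

theorem ae_hittingTime_lt_top (hX : IsMetropolisChain G H β a P X) (hG : G.Connected)
    (hD : D.Nonempty) (ha : a ∉ D) (hT0 : ∀ x ∈ D, T x = 0)
    (hT : ∀ x ∉ D, ∑ y, rate G H β x y * (T y - T x) = -1) :
    ∀ᵐ ω ∂P, hittingTime X D ω < ∞ := by
  have h1 : P.real {ω | hittingTime X D ω = ∞} ≤ 0 := by
    refine ge_of_tendsto (hX.tendsto_survival hG hD ha hT0 hT) ?_
    filter_upwards [eventually_ge_atTop 0] with t ht
    rw [← hX.measureReal_lt_hittingTime ha ht]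
    refine measureReal_mono fun ω hω => ?_
    rw [Set.mem_ofPred_eq] at hω ⊢
    rw [hω]
    exact ENNReal.ofReal_lt_top
  have h2 : P {ω | hittingTime X D ω = ∞} = 0 := by
    rwa [← measureReal_eq_zero_iff, ← measureReal_nonneg.ge_iff_eq']
  filter_upwards [show ∀ᵐ ω ∂P, ¬ hittingTime X D ω = ∞ from measure_eq_zero_iff_ae_notMem.1 h2]
    with ω hω using lt_top_iff_ne_top.2 hω

theorem measureReal_lt_toReal_hittingTime (hX : IsMetropolisChain G H β a P X)
    (hG : G.Connected) (hD : D.Nonempty) (ha : a ∉ D) (hT0 : ∀ x ∈ D, T x = 0)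
    (hT : ∀ x ∉ D, ∑ y, rate G H β x y * (T y - T x) = -1) {t : ℝ} (ht : 0 ≤ t) :
    P.real {ω | t < (hittingTime X D ω).toReal} = survival G H β a D t := by
  rw [← hX.measureReal_lt_hittingTime ha ht]
  refine measureReal_congr ?_
  filter_upwards [hX.ae_hittingTime_lt_top hG hD ha hT0 hT] with ω hω
  exact propext (ENNReal.ofReal_lt_iff_lt_toReal ht hω.ne).symm

/-- The mean hitting time solves a Dirichlet problem. -/
theorem lintegral_hittingTime (hX : IsMetropolisChain G H β a P X) (hG : G.Connected)
    (hD : D.Nonempty) (ha : a ∉ D) (hT0 : ∀ x ∈ D, T x = 0)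
    (hT : ∀ x ∉ D, ∑ y, rate G H β x y * (T y - T x) = -1) :
    ∫⁻ ω, hittingTime X D ω ∂P = ENNReal.ofReal (T a) := by
  obtain ⟨hint, hval⟩ := hX.integrableOn_survival hG hD ha hT0 hT
  calc ∫⁻ ω, hittingTime X D ω ∂P
      = ∫⁻ ω, ENNReal.ofReal (hittingTime X D ω).toReal ∂P := by
        refine lintegral_congr_ae ?_
        filter_upwards [hX.ae_hittingTime_lt_top hG hD ha hT0 hT] with ω hω
        rw [ENNReal.ofReal_toReal hω.ne]
    _ = ∫⁻ t in Set.Ioi (0 : ℝ), P {ω | t < (hittingTime X D ω).toReal} :=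
        lintegral_eq_lintegral_meas_lt P (Eventually.of_forall fun _ => ENNReal.toReal_nonneg)
          (hX.measurable_hittingTime D).ennreal_toReal.aemeasurable
    _ = ∫⁻ t in Set.Ioi (0 : ℝ), ENNReal.ofReal (survival G H β a D t) := by
        refine setLIntegral_congr_fun measurableSet_Ioi fun t ht => ?_
        rw [← hX.measureReal_lt_toReal_hittingTime hG hD ha hT0 hT (le_of_lt ht),
          ofReal_measureReal]
    _ = ENNReal.ofReal (T a) := by
        rw [← hval, ofReal_integral_eq_lintegral_ofReal hint]
        filter_upwards [ae_restrict_mem measurableSet_Ioi] with t ht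
        exact hX.survival_nonneg ha (le_of_lt ht)

/-- The characteristic function of the hitting time solves a Dirichlet problem. -/
theorem integral_exp_hittingTime (hX : IsMetropolisChain G H β a P X) (hG : G.Connected)
    (hD : D.Nonempty) (ha : a ∉ D) (hT0 : ∀ x ∈ D, T x = 0)
    (hT : ∀ x ∉ D, ∑ y, rate G H β x y * (T y - T x) = -1) {l : ℝ} {ψ : V → ℂ}
    (hψ0 : ∀ x ∈ D, ψ x = 0)
    (hψ : ∀ x ∉ D, ∑ y, (rate G H β x y : ℂ) * (ψ y - ψ x) + Complex.I * l * ψ x =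
      -(Complex.I * l)) :
    ∫ ω, Complex.exp (Complex.I * l * (hittingTime X D ω).toReal) ∂P = 1 + ψ a := by
  obtain ⟨hint, -⟩ := hX.integrableOn_survival hG hD ha hT0 hT
  rw [integral_exp_eq_of_tail (hX.measurable_hittingTime D).ennreal_toReal
    (Eventually.of_forall fun _ => ENNReal.toReal_nonneg)
    (fun t ht => hX.measureReal_lt_toReal_hittingTime hG hD ha hT0 hT (le_of_lt ht)) hint l]
  congr 1
  -- With `c = i l`, the integrand of the tail formula is minus the derivative of a function going
  -- from `ψ a` to `0`.
  have hder := fun t (ht : (0 : ℝ) ≤ t) => hX.hasDerivAt_exp_mul_sum ha hψ0 hψ ht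
  have hlim : Tendsto (fun t : ℝ => Complex.exp (Complex.I * l * t) *
      ∑ y, (killedRow G H β a D t y : ℂ) * ψ y) atTop (𝓝 0) := by
    have h := (hX.tendsto_sum_killedRow hG hD ha hT0 hT ψ).norm
    rw [tendsto_zero_iff_norm_tendsto_zero]
    simpa only [norm_mul, norm_exp_I_mul, one_mul, norm_zero] using h
  have hint' : IntegrableOn (fun t : ℝ => -(Complex.I * l * Complex.exp (Complex.I * l * t) *
      survival G H β a D t)) (Set.Ioi 0) := by
    refine Integrable.neg (Integrable.bdd_mul (c := |l|) (hint.ofReal (𝕜 := ℂ)) ?_ ?_)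
    · exact Continuous.aestronglyMeasurable (by fun_prop)
    · refine Eventually.of_forall fun t => ?_
      rw [norm_mul, norm_exp_I_mul, norm_mul, Complex.norm_I, Complex.norm_real]
      simp
  have hval := integral_Ioi_of_hasDerivAt_of_tendsto
    (hder 0 le_rfl).continuousAt.continuousWithinAt (fun t ht => hder t (le_of_lt ht)) hint' hlim
  rw [integral_neg] at hval
  simpa [killedRow_zero, apply_ite Complex.ofReal] using hval

end IsMetropolisChain

end Metropolis

end

/-! ### Convergence in law. -/

theorem mainTheorem6 {V : Type*} [Fintype V] [DecidableEq V]
    (G : SimpleGraph V) [DecidableRel G.Adj] (hG : G.Connected) (H : V → ℝ)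
    (a b : V) (gate : Set V) (hmeta : Metropolis.IsMetastable G H a b gate)
    {Ω : Set.Ioi (0 : ℝ) → Type*} [∀ β, MeasurableSpace (Ω β)]
    (P : (β : Set.Ioi (0 : ℝ)) → Measure (Ω β)) [∀ β, IsProbabilityMeasure (P β)]
    (X : (β : Set.Ioi (0 : ℝ)) → ℝ≥0 → Ω β → V)
    (hX : ∀ β : Set.Ioi (0 : ℝ), Metropolis.IsMetropolisChain G H (β : ℝ) a (P β) (X β)) :
    ∀ D : Set V, D = {b} ∨ D = Metropolis.cycleOf G H gate b →
      (∀ β, 0 < ∫⁻ ω, Metropolis.hittingTime (X β) D ω ∂(P β) ∧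
        ∫⁻ ω, Metropolis.hittingTime (X β) D ω ∂(P β) < ∞) ∧
      TendstoInDistribution
        (fun β ω => (Metropolis.hittingTime (X β) D ω /
          ∫⁻ ω', Metropolis.hittingTime (X β) D ω' ∂(P β)).toReal)
        atTop (id : ℝ → ℝ) P (expMeasure 1) := by
  intro D hD
  obtain ⟨hb, hdisj⟩ := hmeta.target hG hD
  have haD : a ∉ D := hdisj a (hmeta.mem_cycleOf hG)
  have hDne : D.Nonempty := ⟨b, hb⟩
  choose T hT0 hT using fun β : Set.Ioi (0 : ℝ) => Metropolis.exists_dirichlet_real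
    (q := Metropolis.rate G H β) Metropolis.rate_nonneg (Metropolis.isIrreducible_rate hG) hDne
    (fun _ => -1)
  have hmean : ∀ β, ∫⁻ ω, Metropolis.hittingTime (X β) D ω ∂(P β) = ENNReal.ofReal (T β a) :=
    fun β => (hX β).lintegral_hittingTime hG hDne haD (hT0 β) (hT β)
  have hTpos : ∀ β, 0 < T β a := fun β => by
    -- The frequency is irrelevant here; only the positivity of `T a` is taken from the bound.
    obtain ⟨C, δ, -, h⟩ := hmeta.exists_charFun_bound hG hD 0
    exact (h β (le_of_lt β.2) (T β) (hT0 β) (hT β)).1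
  refine ⟨fun β => ?_, ?_⟩
  · rw [hmean]
    exact ⟨ENNReal.ofReal_pos.2 (hTpos β), ENNReal.ofReal_lt_top⟩
  have hmeas : ∀ β : Set.Ioi (0 : ℝ), Measurable fun ω => (Metropolis.hittingTime (X β) D ω /
      ∫⁻ ω', Metropolis.hittingTime (X β) D ω' ∂(P β)).toReal := fun β =>
    (((hX β).measurable_hittingTime D).div_const _).ennreal_toReal
  refine ⟨fun β => (hmeas β).aemeasurable, aemeasurable_id, ?_⟩
  refine tendsto_of_seq_tendsto fun β hβ => ?_
  refine ProbabilityMeasure.tendsto_of_tendsto_charFun fun u => ?_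
  change Tendsto (fun n => charFun ((P (β n)).map fun ω => (Metropolis.hittingTime (X (β n)) D ω /
    ∫⁻ ω', Metropolis.hittingTime (X (β n)) D ω' ∂(P (β n))).toReal) u) atTop
    (𝓝 (charFun ((expMeasure 1).map id) u))
  rw [Measure.map_id, Metropolis.charFun_expMeasure_one]
  obtain ⟨C, δ, hδ, hbound⟩ := hmeta.exists_charFun_bound hG hD u
  -- Frequency `u` for the rescaled time is frequency `u / T a` for the hitting time itself.
  choose ψ hψ0 hψ using fun β : Set.Ioi (0 : ℝ) => Metropolis.exists_dirichlet
    (q := Metropolis.rate G H β) Metropolis.rate_nonneg (Metropolis.isIrreducible_rate hG) hDne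
    (u / T β a) (fun _ => -(Complex.I * (u / T β a : ℝ)))
  have hchar : ∀ β : Set.Ioi (0 : ℝ), charFun ((P β).map fun ω =>
      (Metropolis.hittingTime (X β) D ω /
        ∫⁻ ω', Metropolis.hittingTime (X β) D ω' ∂(P β)).toReal) u = 1 + ψ β a := by
    intro β
    rw [charFun_apply_real, integral_map (hmeas β).aemeasurable (by fun_prop),
      ← (hX β).integral_exp_hittingTime hG hDne haD (hT0 β) (hT β) (hψ0 β) (hψ β)]
    refine integral_congr_ae (Eventually.of_forall fun ω => ?_)
    simp only [hmean, ENNReal.toReal_div, ENNReal.toReal_ofReal (hTpos β).le]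
    congr 1
    push_cast
    ring
  simp only [hchar]
  have hne : (1 - Complex.I * u : ℂ) ≠ 0 := fun h => by
    have := congrArg Complex.re h
    simp at this
  have hβ' : Tendsto (fun n => ((β n : Set.Ioi (0 : ℝ)) : ℝ)) atTop atTop :=
    tendsto_Ioi_atTop.1 hβ
  have hexp : Tendsto (fun n => C * Real.exp (-(β n : ℝ) * δ)) atTop (𝓝 0) := by
    have h1 : Tendsto (fun n => (β n : ℝ) * δ) atTop atTop := hβ'.atTop_mul_const hδ
    simpa using (Real.tendsto_exp_neg_atTop_nhds_zero.comp h1).const_mul C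
  have hlim : Tendsto (fun n => (1 + ψ (β n) a) * (1 - Complex.I * u) - 1) atTop (𝓝 0) :=
    squeeze_zero_norm (fun n => (hbound (β n) (le_of_lt (β n).2) (T (β n)) (hT0 _) (hT _)).2
      (ψ (β n)) (hψ0 _) (hψ _)) hexp
  have h2 := (hlim.add_const 1).mul_const ((1 - Complex.I * u : ℂ)⁻¹)
  simpa [mul_assoc, mul_inv_cancel₀ hne] using h2
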